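/- Let $n,d\in\mathbb N$, $\mathrm D_t=-\mathrm i\partial_t$, and for $c>0$ let $\mathcal Z_{\rm hyp}(c)=\{(t,\xi)\in[0,\infty)\times\mathbb R^n : (1+t)|\xi|\ge c\}$. For integers $m_1,m_2$ let $\mathcal S_*\{m_1,m_2\}$ be the set of all (scalar or matrix-valued) $a\in C^\infty([0,\infty)\times(\mathbb R^n\setminus\{0\}))$ for which there is $c_0>0$ such that for all $k$ and all multi-indices $\alpha$ $$|\partial_t^k\partial_\xi^\alpha a(t,\xi)|\le C_{k,\alpha}|\xi|^{m_1-|\alpha|}(1+t)^{-m_2-k}\qquad\text{for all }(t,\xi)\in\mathcal Z_{\rm hyp}(c_0).$$ Consider a system $\mathrm D_tU=A(t,\mathrm D_x)U$ with a $d\times d$ matrix symbol $A\in\mathcal S_*\{1,0\}$ that is uniformly strictly hyperbolic: (A1) there is $A_1\in\mathcal S_*\{1,0\}$ with $A_1(t,\rho\xi)=\rho A_1(t,\xi)$ for $\rho>0$ and $A-A_1\in\mathcal S_*\{0,1\}$; (A2) the eigenvalues $\lambda_1(t,\xi),\dots,\lambda_d(t,\xi)$ of $A_1(t,\xi)$ are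 real and $\inf_{t\ge0,\ \xi\ne0}|\lambda_i(t,\xi)-\lambda_j(t,\xi)|/|\xi|>0$ for all $i\ne j$. Let $\mathcal E(t,s,\xi)$ ($s,t\ge 0$, $\xi\neq0$) be the fundamental solution, $\mathrm D_t\mathcal E(t,s,\xi)=A(t,\xi)\mathcal E(t,s,\xi)$, $\mathcal E(s,s,\xi)=\mathrm I$. The system has the generalised energy conservation property if for some $c>0$ the norm $\|\mathcal E(t,s,\xi)\|$ is bounded uniformly in $(t,\xi),(s,\xi)\in\mathcal Z_{\rm hyp}(c)$, regardless of the order of $s$ and $t$. For a diagonaliser $M$ of $A_1$, that is, $M(t,\xi)$ is invertible and $M^{-1}A_1M$ is diagonal for all $t\ge0$, $\xi\ne0$, put $$R_0=M^{-1}(A-A_1)M+(\mathrm D_tM^{-1})M,\qquad F^{(0)}=\operatorname{diag}R_0 .$$ Then the following hold. 1. For every diagonaliser $M$ of $A_1$ with $M,M^{-1}\in\mathcal S_*\{0,0\}$, the system has the generalised energy conservation property if and only if for some zone constant $c>0$ $$\sup_{(t,\xi),(s,\xi)\in\mathcal Z_{\rm hyp}(c)}\Big\|\int_s^t\operatorname{Im}F^{(0)}(\tau,\xi)\,\mathrm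 d\tau\Big\|<\infty .$$ 2. Let $\mathcal M$ be the set of those diagonalisers $M$ of $A_1$ for which $M$ and $M^{-1}$ are smooth in $t\in[0,\infty)$ for each $\xi\ne0$ and there is $c_0>0$ such that $\|\partial_t^kM(t,\xi)\|+\|\partial_t^kM^{-1}(t,\xi)\|\le C_k(1+t)^{-k}$ for all $k$ and all $(t,\xi)\in\mathcal Z_{\rm hyp}(c_0)$. Then $\mathcal M$ is not empty, and the equivalence of part 1 holds for every $M\in\mathcal M$. -/

import Mathlib

open scoped ContDiff Matrix.Norms.Operator

noncomputable section

namespace HypSys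

/-- The frequency space `ℝⁿ` with its Euclidean norm. -/
abbrev Freq (n : ℕ) : Type := EuclideanSpace ℝ (Fin n)

/-- Complex `d × d` matrices; they carry a fixed submultiplicative norm (all norms on this
finite-dimensional space are equivalent, so its choice does not affect any notion below).
Derivatives and integrals of matrix-valued functions are taken entry by entry. -/
abbrev Mat (d : ℕ) : Type := Matrix (Fin d) (Fin d) ℂ

/-- `(t, ξ)` lies in the zone `{(t, ξ) : t ≥ 0, (1 + t) |ξ| ≥ c}`. -/
def InZone {n : ℕ} (c t : ℝ) (ξ : Freq n) : Prop :=
  0 ≤ t ∧ c ≤ (1 + t) * ‖ξ‖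

/-- The class `S_*{m₁, m₂}` of scalar functions that are smooth on `[0, ∞) × (ℝⁿ \ {0})` and
satisfy `|∂_t^k ∂_ξ^α a(t, ξ)| ≤ C_{k,α} |ξ|^{m₁ - |α|} (1 + t)^{-m₂ - k}` uniformly in
`(1 + t) |ξ| ≥ c₀` for some `c₀ > 0`.  All `ξ`-derivatives of order `m = |α|` are collected in the
`m`-th Fréchet derivative with respect to `ξ`. -/
def IsScalarSymbol {n : ℕ} (m₁ m₂ : ℤ) (a : ℝ → Freq n → ℂ) : Prop :=
  ContDiffOn ℝ ∞ (fun p : ℝ × Freq n => a p.1 p.2) (Set.Ici 0 ×ˢ {0}ᶜ) ∧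
  ∃ c₀ : ℝ, 0 < c₀ ∧ ∀ k m : ℕ, ∃ C : ℝ, ∀ (t : ℝ) (ξ : Freq n), InZone c₀ t ξ →
    ‖iteratedDerivWithin k (fun τ => iteratedFDeriv ℝ m (a τ) ξ) (Set.Ici 0) t‖
      ≤ C * ‖ξ‖ ^ (m₁ - (m : ℤ)) * (1 + t) ^ (-(m₂ + (k : ℤ)))

/-- The class `S_*{m₁, m₂}` for matrix-valued functions: all entries belong to the class. -/
def IsSymbol {n d : ℕ} (m₁ m₂ : ℤ) (a : ℝ → Freq n → Mat d) : Prop :=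
  ∀ i j, IsScalarSymbol m₁ m₂ (fun t ξ => a t ξ i j)

/-- The fibrewise variant of the scalar class `S_*{m₁, m₂}`: only the regularity in `t` and the
estimates of the `t`-derivatives are required, uniformly in `(1 + t) |ξ| ≥ c₀` for some
`c₀ > 0`. -/
def IsScalarTimeSymbol {n : ℕ} (m₁ m₂ : ℤ) (a : ℝ → Freq n → ℂ) : Prop :=
  (∀ ξ : Freq n, ξ ≠ 0 → ContDiffOn ℝ ∞ (fun t => a t ξ) (Set.Ici 0)) ∧
  ∃ c₀ : ℝ, 0 < c₀ ∧ ∀ k : ℕ, ∃ C : ℝ, ∀ (t : ℝ) (ξ : Freq n), InZone c₀ t ξ →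
    ‖iteratedDerivWithin k (fun τ => a τ ξ) (Set.Ici 0) t‖
      ≤ C * ‖ξ‖ ^ m₁ * (1 + t) ^ (-(m₂ + (k : ℤ)))

/-- The fibrewise class for matrix-valued functions: all entries belong to the class. -/
def IsTimeSymbol {n d : ℕ} (m₁ m₂ : ℤ) (a : ℝ → Freq n → Mat d) : Prop :=
  ∀ i j, IsScalarTimeSymbol m₁ m₂ (fun t ξ => a t ξ i j)

/-- The system `D_t U = A(t, D_x) U` is uniformly strictly hyperbolic with homogeneous principal
part `A₁`. -/
structure IsUniformlyStrictlyHyperbolic {n d : ℕ} (A A₁ : ℝ → Freq n → Mat d) : Prop where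
  /-- `A ∈ S_*{1, 0}`; nothing is required at `ξ = 0`. -/
  symbol : IsSymbol 1 0 A
  /-- `A₁ ∈ S_*{1, 0}`. -/
  principal_symbol : IsSymbol 1 0 A₁
  /-- `A₁` is positively homogeneous of degree one in `ξ`. -/
  principal_homogeneous : ∀ t : ℝ, 0 ≤ t → ∀ ξ : Freq n, ξ ≠ 0 → ∀ ρ : ℝ, 0 < ρ →
    A₁ t (ρ • ξ) = ρ • A₁ t ξ
  /-- `A - A₁ ∈ S_*{0, 1}`. -/
  lower_order : IsSymbol 0 1 (fun t ξ => A t ξ - A₁ t ξ)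
  /-- The `d` eigenvalues of `A₁` are real and uniformly distinct. -/
  eigenvalues : ∃ κ : ℝ, 0 < κ ∧ ∀ t : ℝ, 0 ≤ t → ∀ ξ : Freq n, ξ ≠ 0 →
    ∃ ev : Fin d → ℝ,
      (A₁ t ξ).charpoly
        = ∏ j, (Polynomial.X - Polynomial.C ((ev j : ℝ) : ℂ)) ∧
      ∀ i j, i ≠ j → κ * ‖ξ‖ ≤ |ev i - ev j|

/-- `E(t, s, ξ)` is the fundamental solution, for `ξ ≠ 0` and `s, t ≥ 0`:
`D_t E(t, s, ξ) = A(t, ξ) E(t, s, ξ)`, `E(s, s, ξ) = I`, where `D_t = -i ∂_t`. -/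
def IsFundamentalSolution {n d : ℕ} (A : ℝ → Freq n → Mat d) (E : ℝ → ℝ → Freq n → Mat d) :
    Prop :=
  ∀ ξ : Freq n, ξ ≠ 0 → ∀ s : ℝ, 0 ≤ s →
    E s s ξ = 1 ∧
    ∀ t : ℝ, 0 ≤ t → ∀ i j,
      HasDerivWithinAt (fun τ => E τ s ξ i j) (Complex.I * (A t ξ * E t s ξ) i j) (Set.Ici 0) t

/-- Generalised energy conservation: the (unique) fundamental solution is bounded, uniformly in
`(t, ξ)` and `(s, ξ)` in a zone `(1 + t) |ξ| ≥ c`, regardless of the order of `s` and `t`. -/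
def GeneralisedEnergyConservation {n d : ℕ} (A : ℝ → Freq n → Mat d) : Prop :=
  ∃ E : ℝ → ℝ → Freq n → Mat d, IsFundamentalSolution A E ∧
    ∃ c : ℝ, 0 < c ∧ ∃ C : ℝ, ∀ (s t : ℝ) (ξ : Freq n),
      InZone c t ξ → InZone c s ξ → ‖E t s ξ‖ ≤ C

/-- `M` diagonalises `A₁` for all `t ≥ 0` and `ξ ≠ 0`, and `M` and `M⁻¹` both belong to the
class `S` of matrix functions. -/
structure IsDiagonaliser {n d : ℕ} (S : (ℝ → Freq n → Mat d) → Prop)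
    (A₁ M : ℝ → Freq n → Mat d) : Prop where
  isUnit : ∀ t : ℝ, 0 ≤ t → ∀ ξ : Freq n, ξ ≠ 0 → IsUnit (M t ξ)
  isDiag : ∀ t : ℝ, 0 ≤ t → ∀ ξ : Freq n, ξ ≠ 0 → ((M t ξ)⁻¹ * A₁ t ξ * M t ξ).IsDiag
  symbol : S M
  symbol_inv : S (fun t ξ => (M t ξ)⁻¹)

/-- `D_t a = -i ∂_t a` for a matrix function on `t ≥ 0` (one-sided at `t = 0`). -/
def Dt {n d : ℕ} (a : ℝ → Freq n → Mat d) (t : ℝ) (ξ : Freq n) : Mat d :=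
  Matrix.of fun i j => -Complex.I * derivWithin (fun τ => a τ ξ i j) (Set.Ici 0) t

/-- `R₀ = M⁻¹ (A - A₁) M + (D_t M⁻¹) M`, the remainder in
`D_t V = (M⁻¹ A₁ M + R₀) V` for `V = M⁻¹ Û`. -/
def R₀ {n d : ℕ} (A A₁ M : ℝ → Freq n → Mat d) (t : ℝ) (ξ : Freq n) : Mat d :=
  (M t ξ)⁻¹ * (A t ξ - A₁ t ξ) * M t ξ
    + Dt (fun τ η => (M τ η)⁻¹) t ξ * M t ξ

/-- `F⁽⁰⁾ = diag R₀`. -/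
def F₀ {n d : ℕ} (A A₁ M : ℝ → Freq n → Mat d) (t : ℝ) (ξ : Freq n) : Mat d :=
  Matrix.diagonal (R₀ A A₁ M t ξ).diag

/-- The integrals `∫_s^t Im F⁽⁰⁾(τ, ξ) dτ` are bounded, uniformly in `(t, ξ)` and `(s, ξ)` in a
zone `(1 + t) |ξ| ≥ c`. -/
def BoundedDiagonalIntegrals {n d : ℕ} (A A₁ M : ℝ → Freq n → Mat d) : Prop :=
  ∃ c : ℝ, 0 < c ∧ ∃ C : ℝ, ∀ (s t : ℝ) (ξ : Freq n),
    InZone c t ξ → InZone c s ξ →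
      ‖Matrix.of fun i j => ∫ τ in s..t, (F₀ A A₁ M τ ξ i j).im‖ ≤ C

end HypSys

end

/-! For fixed ξ, V = M⁻¹Û solves D_t V = (D + R₀)V, where D = M⁻¹A₁M is real and diagonal with gaps
at least κ|ξ|, and R₀ = O((1+t)⁻¹) in the zone. A second step replaces M by M(1+N) with [D, N] =
F⁽⁰⁾ − R₀. The gaps make N = O(|ξ|⁻¹(1+t)⁻¹), so 1+N is uniformly invertible once the zone constant
is large, and the new coefficient is D + F⁽⁰⁾ plus an error O(|ξ|⁻¹(1+t)⁻²)
(`IsDiagonaliser.exists_transform`). The integral of this error over [a, ∞) is O(|ξ|⁻¹(1+a)⁻¹),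
hence bounded uniformly for (a, ξ) in the zone. By variation of constants and Gronwall
(`IsFundamentalPair.norm_le_of_perturbation`) the full and the diagonal system are therefore bounded
simultaneously. The diagonal one is solved by exponentials of modulus exp(−∫ Im F⁽⁰⁾), because D is
real; since s and t may be exchanged, boundedness of these moduli is boundedness of the integrals.

Only t-derivatives at fixed ξ enter, so one equivalence (`generalisedEnergyConservation_iff`) serves
the full symbol class and the fibrewise class alike.

For the existence of a fibrewise diagonaliser, the spectral projections P_j are Lagrange polynomials
of |ξ|⁻¹A₁. The ordered eigenvalues are continuous in t and satisfy λ_j' = tr(P_j (|ξ|⁻¹A₁)'), so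
estimates for eigenvalues and projections bootstrap each other. Kato's parallel transport yields a
nowhere vanishing section of the range of P_j; normalised to length one, it satisfies an equation in
P_j' and itself alone, which gives estimates of all orders. These sections are the columns of M.
They are chosen for each ξ separately, so no regularity in ξ is claimed. -/

namespace HypSys

open Set MeasureTheory

/-! ### Linear differential equations: global existence and a Gronwall bound. -/

section LinearODE

variable {E : Type*} [NormedAddCommGroup E] [NormedSpace ℝ E]

/-- The iterates of the Volterra operator `x ↦ ∫₀ᵗ L x`, started at a constant. -/
noncomputable def picardTerm (L : ℝ → E →L[ℝ] E) (x₀ : E) : ℕ → ℝ → E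
  | 0, _ => x₀
  | k + 1, t => ∫ s in (0 : ℝ)..t, L s (picardTerm L x₀ k s)

variable {L : ℝ → E →L[ℝ] E}

theorem continuous_picardTerm (hL : Continuous L) (x₀ : E) (k : ℕ) :
    Continuous (picardTerm L x₀ k) := by
  induction k with
  | zero => exact continuous_const
  | succ k ih =>
    exact intervalIntegral.continuous_primitive
      (fun a b => (hL.clm_apply ih).intervalIntegrable a b) 0

/-- Each Volterra iteration integrates a power of |s|, which produces the factorial and makes the
Picard series converge on every bounded interval. -/
theorem norm_picardTerm_le (hL : Continuous L) (x₀ : E) {T K : ℝ}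
    (hK : ∀ t, |t| ≤ T → ‖L t‖ ≤ K) (k : ℕ) {t : ℝ} (ht : |t| ≤ T) :
    ‖picardTerm L x₀ k t‖ ≤ ‖x₀‖ * ((K * |t|) ^ k / k.factorial) := by
  induction k generalizing t with
  | zero => simp [picardTerm]
  | succ k ih =>
    have hK0 : 0 ≤ K := (norm_nonneg _).trans (hK t ht)
    have hsub : ∀ s ∈ uIoc 0 t, |s| ≤ T := fun s hs => by
      refine le_trans ?_ ht
      have := abs_sub_left_of_mem_uIcc (uIoc_subset_uIcc hs)
      simpa using this
    have hcont := hL.clm_apply (continuous_picardTerm hL x₀ k)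
    have hint : ∀ f : ℝ → ℝ, Continuous f → IntegrableOn f (uIoc 0 t) volume := fun f hf =>
      (hf.integrableOn_Icc (a := min 0 t) (b := max 0 t)).mono_set Ioc_subset_Icc_self
    calc ‖picardTerm L x₀ (k + 1) t‖
        ≤ ∫ s in uIoc 0 t, ‖L s (picardTerm L x₀ k s)‖ :=
          intervalIntegral.norm_integral_le_integral_norm_uIoc
      _ ≤ ∫ s in uIoc 0 t, (K * (‖x₀‖ * (K ^ k / k.factorial))) * |s - 0| ^ k := by
          refine setIntegral_mono_on (hint _ hcont.norm) (hint _ (by fun_prop))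
            measurableSet_uIoc fun s hs => ?_
          refine ((L s).le_opNorm _).trans ?_
          refine (mul_le_mul (hK s (hsub s hs)) (ih (hsub s hs)) (norm_nonneg _) hK0).trans
            (le_of_eq ?_)
          rw [sub_zero, mul_pow]; ring
      _ = ‖x₀‖ * ((K * |t|) ^ (k + 1) / (k + 1).factorial) := by
          rw [integral_const_mul, integral_pow_abs_sub_uIoc, sub_zero, Nat.factorial_succ]
          push_cast
          have : (k.factorial : ℝ) ≠ 0 := by positivity
          field_simp
          ring

/-- Global existence for linear ordinary differential equations. -/
theorem exists_linear_ode [CompleteSpace E] (hL : Continuous L) (x₀ : E) :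
    ∃ x : ℝ → E, x 0 = x₀ ∧ ∀ t, HasDerivAt x (L t (x t)) t := by
  refine ⟨fun t => ∑' k, picardTerm L x₀ k t, ?_, fun t => ?_⟩
  · refine (tsum_eq_single 0 ?_).trans rfl
    rintro (_ | k) hk
    · exact absurd rfl hk
    · simp [picardTerm]
  -- Termwise differentiation takes place on the bounded interval (−T, T) around t, on which the
  -- norm of `L` has a bound K.
  · set T := |t| + 1 with hT
    obtain ⟨K, hK⟩ := isCompact_Icc.exists_bound_of_continuousOn (s := Icc (-T) T)
      hL.continuousOn
    replace hK : ∀ s, |s| ≤ T → ‖L s‖ ≤ K := fun s hs => hK s (abs_le.1 hs)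
    have hT0 : 0 ≤ T := by positivity
    have hK0 : 0 ≤ K := (norm_nonneg _).trans (hK 0 (by simpa using hT0))
    have hsummable : ∀ s, |s| ≤ T → Summable fun k => picardTerm L x₀ k s := fun s hs =>
      Summable.of_norm_bounded ((Real.summable_pow_div_factorial (K * |s|)).mul_left ‖x₀‖)
        fun k => norm_picardTerm_le hL x₀ hK k hs
    -- The index is shifted: the constant term has derivative 0, and term k + 1 has derivative `L`
    -- applied to term k.
    let g' : ℕ → ℝ → E := fun k s => Nat.casesOn k 0 fun k => L s (picardTerm L x₀ k s)
    let u : ℕ → ℝ := fun k => Nat.casesOn k 0 fun k => K * (‖x₀‖ * ((K * T) ^ k / k.factorial))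
    have hmem : t ∈ Ioo (-T) T := by
      constructor <;> [have := neg_abs_le t; have := le_abs_self t] <;> linarith
    have hu : Summable u := (summable_nat_add_iff 1).1
      (((Real.summable_pow_div_factorial (K * T)).mul_left ‖x₀‖).mul_left K)
    have hd : ∀ k, ∀ s ∈ Ioo (-T) T, HasDerivAt (picardTerm L x₀ k) (g' k s) s := by
      rintro (_ | k) s -
      · exact hasDerivAt_const _ _
      · have hc := hL.clm_apply (continuous_picardTerm hL x₀ k)
        exact intervalIntegral.integral_hasDerivAt_right (hc.intervalIntegrable _ _)
          (hc.stronglyMeasurableAtFilter _ _) hc.continuousAt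
    have hb : ∀ k, ∀ s ∈ Ioo (-T) T, ‖g' k s‖ ≤ u k := by
      rintro (_ | k) s hs
      · simp [g', u]
      · have hs' : |s| ≤ T := abs_le.2 ⟨hs.1.le, hs.2.le⟩
        refine ((L s).le_opNorm _).trans (mul_le_mul (hK s hs') ?_ (norm_nonneg _) hK0)
        refine (norm_picardTerm_le hL x₀ hK k hs').trans ?_
        gcongr
    have hs := hsummable t (abs_le.2 ⟨hmem.1.le, hmem.2.le⟩)
    have key := hasDerivAt_tsum_of_isPreconnected hu isOpen_Ioo isPreconnected_Ioo hd hb hmem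
      hs hmem
    have e : ∑' k, g' k t = L t (∑' k, picardTerm L x₀ k t) := by
      have h1 : Summable fun k => L t (picardTerm L x₀ k t) := hs.mapL (L t)
      have h2 : Summable fun k => g' k t := (summable_nat_add_iff 1).1 h1
      rw [(L t).map_tsum hs, h2.tsum_eq_zero_add]
      exact zero_add _
    exact e ▸ key

theorem eq_of_hasDerivWithinAt_zero {f : ℝ → E} {a : ℝ}
    (hf : ∀ t, a ≤ t → HasDerivWithinAt f 0 (Ici a) t) {s t : ℝ} (hs : a ≤ s) (ht : a ≤ t) :
    f t = f s := by
  have key : ∀ t, a ≤ t → f t = f a := fun t ht =>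
    constant_of_has_deriv_right_zero
      (fun x hx => ((hf x hx.1).continuousWithinAt).mono Icc_subset_Ici_self)
      (fun x hx => (hf x hx.1).mono (Ici_subset_Ici.2 hx.1)) t ⟨ht, le_rfl⟩
  rw [key t ht, key s hs]

/-- Gronwall's inequality with the integrable coefficient `k (1 + t)⁻²`. -/
theorem norm_le_exp_of_norm_deriv_le {f f' : ℝ → E} {s k : ℝ} (hs : 0 ≤ s) (hk : 0 < k)
    (hf : ∀ t, s ≤ t → HasDerivWithinAt f (f' t) (Ici s) t)
    (hbound : ∀ t, s ≤ t → ‖f' t‖ ≤ k / (1 + t) ^ 2 * ‖f t‖) {t : ℝ} (ht : s ≤ t) :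
    ‖f t‖ ≤ (‖f s‖ + 1) * Real.exp (2 * k / (1 + s)) := by
  -- The comparison argument needs a strict inequality wherever ‖f‖ meets the barrier: the factor 2
  -- supplies it, and the summand 1 keeps the barrier positive.
  set B : ℝ → ℝ := fun x => (‖f s‖ + 1) * Real.exp (2 * k / (1 + s) - 2 * k / (1 + x)) with hB
  have hBd : ∀ x, s ≤ x → HasDerivAt B (B x * (2 * k / (1 + x) ^ 2)) x := fun x hx => by
    have h1 : (1 + x) ≠ 0 := by linarith
    have h2 : HasDerivAt (fun x : ℝ => 2 * k / (1 + s) - 2 * k / (1 + x))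
        (2 * k / (1 + x) ^ 2) x := by
      have := (((hasDerivAt_id x).const_add 1).fun_inv h1).const_mul (2 * k)
      exact (this.const_sub (2 * k / (1 + s))).congr_deriv (by simp; ring)
    exact (h2.exp.const_mul (‖f s‖ + 1)).congr_deriv (by simp only [hB]; ring)
  have hpos : ∀ x, 0 < B x := fun x => by positivity
  refine (image_norm_le_of_norm_deriv_right_lt_deriv_boundary' (a := s) (b := t) (f := f)
    (f' := f') (B := B) (B' := fun x => B x * (2 * k / (1 + x) ^ 2)) ?_ ?_ ?_ ?_ ?_ ?_
    ⟨ht, le_rfl⟩).trans ?_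
  · exact fun x hx => ((hf x hx.1).continuousWithinAt).mono Icc_subset_Ici_self
  · exact fun x hx => (hf x hx.1).mono (Ici_subset_Ici.2 hx.1)
  · simp [hB]
  · exact fun x hx => (hBd x hx.1).continuousAt.continuousWithinAt
  · exact fun x hx => (hBd x hx.1).hasDerivWithinAt
  · intro x hx hxB
    have h1 : 0 < 1 + x := by linarith [hx.1]
    refine (hbound x hx.1).trans_lt ?_
    rw [hxB, mul_comm]
    have := hpos x
    gcongr
    linarith
  · simp only [hB]
    have : 0 ≤ 2 * k / (1 + t) := by have : 0 ≤ t := hs.trans ht; positivity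
    gcongr
    linarith

end LinearODE

/-! ### Fundamental solutions as products of mutually inverse solutions, and their stability. -/

section FundamentalPair

variable {𝔸 : Type*} [NormedRing 𝔸] [NormedAlgebra ℝ 𝔸]

/-- `X` and `Y` are mutually inverse solutions of `X' = P X` and `Y' = -Y P` on `[a, ∞)`; the
fundamental solution is `X(t) Y(s)`. -/
structure IsFundamentalPair (a : ℝ) (P X Y : ℝ → 𝔸) : Prop where
  deriv_left : ∀ t, a ≤ t → HasDerivWithinAt X (P t * X t) (Ici a) t
  deriv_right : ∀ t, a ≤ t → HasDerivWithinAt Y (-(Y t * P t)) (Ici a) t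
  right_mul_left : ∀ t, a ≤ t → Y t * X t = 1

namespace IsFundamentalPair

variable {a : ℝ} {P X Y : ℝ → 𝔸}

theorem left_mul_right [IsDedekindFiniteMonoid 𝔸] (h : IsFundamentalPair a P X Y) {t : ℝ} (ht : a ≤ t) :
    X t * Y t = 1 := mul_eq_one_comm.1 (h.right_mul_left t ht)

theorem mono (h : IsFundamentalPair a P X Y) {b : ℝ} (hb : a ≤ b) :
    IsFundamentalPair b P X Y where
  deriv_left t ht := (h.deriv_left t (hb.trans ht)).mono (Ici_subset_Ici.2 hb)
  deriv_right t ht := (h.deriv_right t (hb.trans ht)).mono (Ici_subset_Ici.2 hb)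
  right_mul_left t ht := h.right_mul_left t (hb.trans ht)

end IsFundamentalPair

/-- `Y` is obtained from its own equation rather than as an inverse of `X`: the product rule then
gives (YX)' = 0 at once. Freezing `P` at `P 0` for negative times provides a coefficient on the
whole line. -/
theorem exists_isFundamentalPair [CompleteSpace 𝔸] {P : ℝ → 𝔸} (hP : ContinuousOn P (Ici 0)) :
    ∃ X Y : ℝ → 𝔸, X 0 = 1 ∧ Y 0 = 1 ∧ IsFundamentalPair 0 P X Y := by
  have hc : Continuous fun t => P (max t 0) :=
    hP.comp_continuous (by fun_prop) fun t => le_max_right t 0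
  obtain ⟨X, hX0, hX⟩ := exists_linear_ode
    (L := fun t => ContinuousLinearMap.mul ℝ 𝔸 (P (max t 0)))
    ((ContinuousLinearMap.mul ℝ 𝔸).continuous.comp hc) 1
  obtain ⟨Y, hY0, hY⟩ := exists_linear_ode
    (L := fun t => -(ContinuousLinearMap.mul ℝ 𝔸).flip (P (max t 0)))
    ((ContinuousLinearMap.mul ℝ 𝔸).flip.continuous.comp hc).neg 1
  have hX' : ∀ t : ℝ, 0 ≤ t → HasDerivWithinAt X (P t * X t) (Ici 0) t := fun t ht => by
    simpa [max_eq_left ht] using (hX t).hasDerivWithinAt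
  have hY' : ∀ t : ℝ, 0 ≤ t → HasDerivWithinAt Y (-(Y t * P t)) (Ici 0) t := fun t ht => by
    simpa [max_eq_left ht] using (hY t).hasDerivWithinAt
  refine ⟨X, Y, hX0, hY0, hX', hY', fun t ht => ?_⟩
  have := eq_of_hasDerivWithinAt_zero (f := fun t => Y t * X t) (a := 0) (fun t ht => by
    exact ((hY' t ht).mul (hX' t ht)).congr_deriv (by noncomm_ring)) le_rfl ht
  simpa [hX0, hY0] using this

/-- Perturbation by a coefficient of size `k (1 + t)⁻²` preserves two-sided boundedness of the
fundamental solution. -/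
theorem IsFundamentalPair.norm_le_of_perturbation [IsDedekindFiniteMonoid 𝔸] {a C k : ℝ} {P Q X Y X' Y' : ℝ → 𝔸}
    (h : IsFundamentalPair a P X Y) (h' : IsFundamentalPair a Q X' Y') (ha : 0 ≤ a)
    (hk : 0 ≤ k) (hC : ∀ s t, a ≤ s → a ≤ t → ‖X t * Y s‖ ≤ C)
    (hQ : ∀ t, a ≤ t → ‖Q t - P t‖ ≤ k / (1 + t) ^ 2) {s t : ℝ} (hs : a ≤ s) (ht : a ≤ t) :
    ‖X' t * Y' s‖ ≤ C * ((‖(1 : 𝔸)‖ + 1) * Real.exp (2 * (C * k * C + k + 1) / (1 + a))) := by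
  have hC0 : 0 ≤ C := (norm_nonneg _).trans (hC s t hs ht)
  -- Conjugating Q − P by the bounded propagators costs C twice; the extra k + 1 only serves to make
  -- the Gronwall constant strictly positive.
  have hk' : 0 < C * k * C + k + 1 := by positivity
  have hexp : ∀ b, a ≤ b → (‖(1 : 𝔸)‖ + 1) * Real.exp (2 * (C * k * C + k + 1) / (1 + b)) ≤
      (‖(1 : 𝔸)‖ + 1) * Real.exp (2 * (C * k * C + k + 1) / (1 + a)) := fun b hb => by
    gcongr
  have hcoef : ∀ b τ, a ≤ b → b ≤ τ →
      ‖X b * Y τ * (Q τ - P τ) * (X τ * Y b)‖ ≤ (C * k * C + k + 1) / (1 + τ) ^ 2 := by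
    intro b τ hb hτ
    have haτ := hb.trans hτ
    have h0 : 0 < 1 + τ := by linarith
    calc _ ≤ ‖X b * Y τ‖ * ‖Q τ - P τ‖ * ‖X τ * Y b‖ :=
          (norm_mul_le _ _).trans (by gcongr; exact norm_mul_le _ _)
      _ ≤ C * (k / (1 + τ) ^ 2) * C := by
          gcongr
          exacts [hC _ _ haτ hb, hQ _ haτ, hC _ _ hb haτ]
      _ = C * k * C / (1 + τ) ^ 2 := by ring
      _ ≤ _ := by gcongr; linarith
  rcases le_total s t with hst | hst
  -- Variation of constants: the perturbed propagator, pulled back by the unperturbed one, solves Z'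
  -- = KZ, where K is Q − P conjugated by the unperturbed propagator.
  · have hd : ∀ τ, s ≤ τ → HasDerivWithinAt (fun τ => X s * Y τ * (X' τ * Y' s))
        (X s * Y τ * (Q τ - P τ) * (X τ * Y s) * (X s * Y τ * (X' τ * Y' s))) (Ici s) τ := by
      intro τ hτ
      have haτ := hs.trans hτ
      refine ((((h.mono hs).deriv_right τ hτ).const_mul (X s)).mul
        (((h'.mono hs).deriv_left τ hτ).mul_const (Y' s))).congr_deriv ?_
      have e : X τ * Y s * (X s * Y τ * (X' τ * Y' s)) = X' τ * Y' s := by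
        have e1 := h.right_mul_left s hs
        have e2 := h.left_mul_right haτ
        calc _ = X τ * (Y s * X s) * Y τ * (X' τ * Y' s) := by simp only [mul_assoc]
          _ = _ := by rw [e1, mul_one, e2, one_mul]
      rw [mul_assoc _ (X τ * Y s), e]
      noncomm_ring
    have := norm_le_exp_of_norm_deriv_le (ha.trans hs) hk' hd (fun τ hτ =>
      (norm_mul_le _ _).trans (by gcongr; exact hcoef s τ hs hτ)) hst
    simp only [h.left_mul_right hs, h'.left_mul_right hs, one_mul] at this
    have e : X' t * Y' s = X t * Y s * (X s * Y t * (X' t * Y' s)) := by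
      have e1 := h.right_mul_left s hs
      have e2 := h.left_mul_right ht
      calc _ = X t * (Y s * X s) * Y t * (X' t * Y' s) := by rw [e1, mul_one, e2, one_mul]
        _ = _ := by simp only [mul_assoc]
    rw [e]
    refine (norm_mul_le _ _).trans ?_
    gcongr
    exacts [hC _ _ hs ht, this.trans (hexp s hs)]
  -- For t ≤ s the second time argument moves forward from t instead, so that the coefficient
  -- multiplies from the right and Gronwall still runs in the direction of increasing time.
  · have hd : ∀ τ, t ≤ τ → HasDerivWithinAt (fun τ => X' t * Y' τ * (X τ * Y t))
        (-(X' t * Y' τ * (X τ * Y t)) * (X t * Y τ * (Q τ - P τ) * (X τ * Y t))) (Ici t) τ := by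
      intro τ hτ
      have haτ := ht.trans hτ
      refine ((((h'.mono ht).deriv_right τ hτ).const_mul (X' t)).mul
        (((h.mono ht).deriv_left τ hτ).mul_const (Y t))).congr_deriv ?_
      have e : X τ * Y t * (X t * Y τ * (Q τ - P τ) * (X τ * Y t))
          = (Q τ - P τ) * (X τ * Y t) := by
        have e1 := h.right_mul_left t ht
        have e2 := h.left_mul_right haτ
        calc _ = X τ * (Y t * X t) * Y τ * ((Q τ - P τ) * (X τ * Y t)) := by
              simp only [mul_assoc]
          _ = _ := by rw [e1, mul_one, e2, one_mul]
      rw [neg_mul, mul_assoc (X' t * Y' τ), e]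
      noncomm_ring
    have := norm_le_exp_of_norm_deriv_le (ha.trans ht) hk' hd (fun τ hτ =>
      (norm_mul_le _ _).trans (by
        rw [norm_neg, mul_comm]; gcongr; exact hcoef t τ ht hτ)) hst
    simp only [h.left_mul_right ht, h'.left_mul_right ht, one_mul] at this
    have e : X' t * Y' s = X' t * Y' s * (X s * Y t) * (X t * Y s) := by
      have e1 := h.right_mul_left t ht
      have e2 := h.left_mul_right hs
      calc _ = X' t * Y' s * (X s * (Y t * X t) * Y s) := by rw [e1, mul_one, e2, mul_one]
        _ = _ := by simp only [mul_assoc]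
    rw [e, mul_comm C]
    refine (norm_mul_le _ _).trans ?_
    gcongr
    exacts [this.trans (hexp t ht), hC _ _ hs ht]

end FundamentalPair

end HypSys

namespace HypSys

open Set

/-! ### Calculus of symbols in the time variable, with ξ as a parameter. -/

section TimeSymbols

variable {n : ℕ} {c : ℝ}

theorem InZone.ne_zero {t : ℝ} {ξ : Freq n} (h : InZone c t ξ) (hc : 0 < c) : ξ ≠ 0 := by
  rintro rfl
  have := h.2
  simp at this
  linarith

theorem InZone.one_add_pos {t : ℝ} {ξ : Freq n} (h : InZone c t ξ) : 0 < 1 + t := by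
  linarith [h.1]

theorem InZone.of_le {c' t : ℝ} {ξ : Freq n} (h : InZone c' t ξ) (hc : c ≤ c') : InZone c t ξ :=
  ⟨h.1, hc.trans h.2⟩

theorem InZone.of_time_le {s t : ℝ} {ξ : Freq n} (h : InZone c s ξ) (hst : s ≤ t) :
    InZone c t ξ :=
  ⟨h.1.trans hst, h.2.trans (by gcongr)⟩

/-- `‖a(t, ξ)‖ ≤ C (1 + t)⁻ᵐ` in the zone `(1 + t) |ξ| ≥ c`. -/
def HasZoneBound (c : ℝ) (m : ℤ) (a : ℝ → Freq n → ℂ) : Prop :=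
  ∃ C : ℝ, ∀ t ξ, InZone c t ξ → ‖a t ξ‖ ≤ C * (1 + t) ^ (-m)

theorem HasZoneBound.exists_nonneg {m : ℤ} {a : ℝ → Freq n → ℂ} (h : HasZoneBound c m a) :
    ∃ C : ℝ, 0 ≤ C ∧ ∀ t ξ, InZone c t ξ → ‖a t ξ‖ ≤ C * (1 + t) ^ (-m) := by
  obtain ⟨C, hC⟩ := h
  refine ⟨|C|, abs_nonneg C, fun t ξ hz => (hC t ξ hz).trans ?_⟩
  have := hz.one_add_pos
  gcongr
  exact le_abs_self C

theorem HasZoneBound.mul {m m' : ℤ} {a b : ℝ → Freq n → ℂ} (ha : HasZoneBound c m a)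
    (hb : HasZoneBound c m' b) : HasZoneBound c (m + m') fun t ξ => a t ξ * b t ξ := by
  obtain ⟨C, hC, ha⟩ := ha.exists_nonneg
  obtain ⟨C', hC', hb⟩ := hb.exists_nonneg
  refine ⟨C * C', fun t ξ hz => ?_⟩
  have := hz.one_add_pos
  calc ‖a t ξ * b t ξ‖ = ‖a t ξ‖ * ‖b t ξ‖ := norm_mul _ _
    _ ≤ (C * (1 + t) ^ (-m)) * (C' * (1 + t) ^ (-m')) := by
        gcongr
        exacts [ha t ξ hz, hb t ξ hz]
    _ = _ := by rw [neg_add, zpow_add₀ this.ne']; ring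

theorem HasZoneBound.add {m : ℤ} {a b : ℝ → Freq n → ℂ} (ha : HasZoneBound c m a)
    (hb : HasZoneBound c m b) : HasZoneBound c m fun t ξ => a t ξ + b t ξ := by
  obtain ⟨C, ha⟩ := ha
  obtain ⟨C', hb⟩ := hb
  refine ⟨C + C', fun t ξ hz => ?_⟩
  rw [add_mul]
  exact (norm_add_le _ _).trans (add_le_add (ha t ξ hz) (hb t ξ hz))

/-- Functions with `N` time derivatives on `[0, ∞)` satisfying
`‖∂ₜᵏ a(t, ξ)‖ ≤ C (1 + t)^(-m-k)`, `k ≤ N`, in the zone `(1 + t) |ξ| ≥ c`. -/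
def IsSymbolUpTo (c : ℝ) : ℕ → ℤ → (ℝ → Freq n → ℂ) → Prop
  | 0, m, a => HasZoneBound c m a ∧ ∀ ξ, ξ ≠ 0 → ContinuousOn (fun t => a t ξ) (Ici 0)
  | N + 1, m, a => HasZoneBound c m a ∧ ∃ b : ℝ → Freq n → ℂ,
      (∀ ξ, ξ ≠ 0 → ∀ t, 0 ≤ t → HasDerivWithinAt (fun τ => a τ ξ) (b t ξ) (Ici 0) t) ∧
        IsSymbolUpTo c N (m + 1) b

namespace IsSymbolUpTo

variable {N : ℕ} {m m' : ℤ} {a b : ℝ → Freq n → ℂ}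

theorem bound (h : IsSymbolUpTo c N m a) : HasZoneBound c m a := by
  cases N <;> exact h.1

theorem continuousOn (h : IsSymbolUpTo c N m a) {ξ : Freq n} (hξ : ξ ≠ 0) :
    ContinuousOn (fun t => a t ξ) (Ici 0) := by
  cases N with
  | zero => exact h.2 ξ hξ
  | succ N =>
    obtain ⟨-, b, hb, -⟩ := h
    exact fun t ht => (hb ξ hξ t ht).continuousWithinAt

theorem of_succ (h : IsSymbolUpTo c (N + 1) m a) : IsSymbolUpTo c N m a := by
  induction N generalizing m a with
  | zero => exact ⟨h.bound, fun ξ hξ => h.continuousOn hξ⟩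
  | succ N ih =>
    obtain ⟨hbd, b, hb, hb'⟩ := h
    exact ⟨hbd, b, hb, ih hb'⟩

theorem mono_zone {c' : ℝ} (h : IsSymbolUpTo c N m a) (hc : c ≤ c') :
    IsSymbolUpTo c' N m a := by
  have hbd : ∀ {m} {a : ℝ → Freq n → ℂ}, HasZoneBound c m a → HasZoneBound c' m a :=
    fun ⟨C, hC⟩ => ⟨C, fun t ξ hz => hC t ξ (hz.of_le hc)⟩
  induction N generalizing m a with
  | zero => exact ⟨hbd h.1, h.2⟩
  | succ N ih =>
    obtain ⟨h1, b, hb, hb'⟩ := h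
    exact ⟨hbd h1, b, hb, ih hb'⟩

theorem congr (hc : 0 < c) (h : IsSymbolUpTo c N m a)
    (hab : ∀ ξ, ξ ≠ 0 → ∀ t, 0 ≤ t → b t ξ = a t ξ) : IsSymbolUpTo c N m b := by
  have hbd : HasZoneBound c m b := by
    obtain ⟨C, hC⟩ := h.bound
    exact ⟨C, fun t ξ hz => hab ξ (hz.ne_zero hc) t hz.1 ▸ hC t ξ hz⟩
  cases N with
  | zero => exact ⟨hbd, fun ξ hξ => (h.continuousOn hξ).congr fun t ht => hab ξ hξ t ht⟩
  | succ N =>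
    obtain ⟨-, a', ha', h'⟩ := h
    exact ⟨hbd, a', fun ξ hξ t ht => (ha' ξ hξ t ht).congr (fun τ hτ => hab ξ hξ τ hτ)
      (hab ξ hξ t ht), h'⟩

theorem zero : IsSymbolUpTo c N m (fun _ (_ : Freq n) => 0) := by
  have hbd : ∀ m, HasZoneBound c m (fun _ (_ : Freq n) => 0) := fun m => ⟨0, by simp⟩
  induction N generalizing m with
  | zero => exact ⟨hbd m, fun ξ _ => continuousOn_const⟩
  | succ N ih => exact ⟨hbd m, _, fun ξ _ t _ => hasDerivWithinAt_const _ _ _, ih⟩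

theorem const (z : ℂ) : IsSymbolUpTo c N 0 (fun _ (_ : Freq n) => z) := by
  have hbd : HasZoneBound c 0 (fun _ (_ : Freq n) => z) := ⟨‖z‖, by simp⟩
  cases N with
  | zero => exact ⟨hbd, fun ξ _ => continuousOn_const⟩
  | succ N => exact ⟨hbd, _, fun ξ _ t _ => hasDerivWithinAt_const _ _ _, zero⟩

theorem add (ha : IsSymbolUpTo c N m a) (hb : IsSymbolUpTo c N m b) :
    IsSymbolUpTo c N m fun t ξ => a t ξ + b t ξ := by
  induction N generalizing m a b with
  | zero =>
    exact ⟨ha.bound.add hb.bound, fun ξ hξ => (ha.continuousOn hξ).add (hb.continuousOn hξ)⟩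
  | succ N ih =>
    have h := ha.bound.add hb.bound
    obtain ⟨-, a', ha', ha⟩ := ha
    obtain ⟨-, b', hb', hb⟩ := hb
    exact ⟨h, _, fun ξ hξ t ht => (ha' ξ hξ t ht).add (hb' ξ hξ t ht), ih ha hb⟩

theorem mul (ha : IsSymbolUpTo c N m a) (hb : IsSymbolUpTo c N m' b) :
    IsSymbolUpTo c N (m + m') fun t ξ => a t ξ * b t ξ := by
  induction N generalizing m m' a b with
  | zero =>
    exact ⟨ha.bound.mul hb.bound, fun ξ hξ => (ha.continuousOn hξ).mul (hb.continuousOn hξ)⟩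
  | succ N ih =>
    have h := ha.bound.mul hb.bound
    have ha₀ := ha.of_succ
    have hb₀ := hb.of_succ
    obtain ⟨-, a', ha', ha⟩ := ha
    obtain ⟨-, b', hb', hb⟩ := hb
    refine ⟨h, _, fun ξ hξ t ht => (ha' ξ hξ t ht).mul (hb' ξ hξ t ht), ?_⟩
    have h1 := ih ha hb₀
    have h2 := ih ha₀ hb
    rw [show m + 1 + m' = m + m' + 1 by ring] at h1
    rw [← add_assoc] at h2
    exact h1.add h2

theorem const_mul (ha : IsSymbolUpTo c N m a) (z : ℂ) :
    IsSymbolUpTo c N m fun t ξ => z * a t ξ := by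
  simpa using (const z).mul ha

theorem neg (ha : IsSymbolUpTo c N m a) : IsSymbolUpTo c N m fun t ξ => -a t ξ := by
  simpa using ha.const_mul (-1)

theorem sub (ha : IsSymbolUpTo c N m a) (hb : IsSymbolUpTo c N m b) :
    IsSymbolUpTo c N m fun t ξ => a t ξ - b t ξ := by
  simpa [sub_eq_add_neg] using ha.add hb.neg

theorem sum {ι : Type*} (s : Finset ι) {f : ι → ℝ → Freq n → ℂ}
    (hf : ∀ i ∈ s, IsSymbolUpTo c N m (f i)) :
    IsSymbolUpTo c N m fun t ξ => ∑ i ∈ s, f i t ξ := by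
  classical
  induction s using Finset.induction_on with
  | empty => simpa using zero
  | insert i s hi ih =>
    simp only [Finset.sum_insert hi]
    exact (hf i (Finset.mem_insert_self i s)).add
      (ih fun j hj => hf j (Finset.mem_insert_of_mem hj))

theorem star (ha : IsSymbolUpTo c N m a) :
    IsSymbolUpTo c N m fun t ξ => starRingEnd ℂ (a t ξ) := by
  have hbd : ∀ {m} {a : ℝ → Freq n → ℂ}, HasZoneBound c m a →
      HasZoneBound c m fun t ξ => starRingEnd ℂ (a t ξ) :=
    fun ⟨C, hC⟩ => ⟨C, fun t ξ hz => by simpa using hC t ξ hz⟩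
  induction N generalizing m a with
  | zero =>
    exact ⟨hbd ha.1, fun ξ hξ => Complex.continuous_conj.comp_continuousOn (ha.2 ξ hξ)⟩
  | succ N ih =>
    obtain ⟨h, a', ha', ha⟩ := ha
    refine ⟨hbd h, _, fun ξ hξ t ht => ?_, ih ha⟩
    exact (Complex.conjCLE.toContinuousLinearMap.hasFDerivAt.comp_hasDerivWithinAt t
      (ha' ξ hξ t ht))

/-- The derivative −a'a⁻² is a product of a' and two factors a⁻¹ already controlled to order N, so
the induction closes. The lower bound δ is needed only in the zone; outside it, nonvanishing
suffices for differentiability. -/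
theorem inv {δ : ℝ} (hδ : 0 < δ) (ha : IsSymbolUpTo c N 0 a)
    (hne : ∀ ξ, ξ ≠ 0 → ∀ t, 0 ≤ t → a t ξ ≠ 0)
    (hlow : ∀ t ξ, InZone c t ξ → δ ≤ ‖a t ξ‖) : IsSymbolUpTo c N 0 fun t ξ => (a t ξ)⁻¹ := by
  have hbd : HasZoneBound c 0 fun t ξ => (a t ξ)⁻¹ := by
    refine ⟨δ⁻¹, fun t ξ hz => ?_⟩
    rw [norm_inv, neg_zero, zpow_zero, mul_one]
    have := hlow t ξ hz
    gcongr
  induction N with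
  | zero => exact ⟨hbd, fun ξ hξ => (ha.2 ξ hξ).inv₀ fun t ht => hne ξ hξ t ht⟩
  | succ N ih =>
    have hi := ih ha.of_succ
    obtain ⟨-, a', ha', ha⟩ := ha
    refine ⟨hbd, _, fun ξ hξ t ht => (ha' ξ hξ t ht).fun_inv (hne ξ hξ t ht), ?_⟩
    have := ((ha.mul hi).mul hi).neg
    simp only [add_zero] at this
    refine cast (congrArg _ (funext₂ fun t ξ => ?_)) this
    field_simp

theorem contDiffOn (h : IsSymbolUpTo c N m a) {ξ : Freq n} (hξ : ξ ≠ 0) :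
    ContDiffOn ℝ N (fun t => a t ξ) (Ici 0) := by
  induction N generalizing m a with
  | zero => exact contDiffOn_zero.2 (h.2 ξ hξ)
  | succ N ih =>
    obtain ⟨-, b, hb, hb'⟩ := h
    push_cast
    rw [contDiffOn_succ_iff_derivWithin (uniqueDiffOn_Ici 0)]
    refine ⟨fun t ht => (hb ξ hξ t ht).differentiableWithinAt, by simp, ?_⟩
    exact (ih hb').congr fun t ht => (hb ξ hξ t ht).derivWithin (uniqueDiffOn_Ici 0 t ht)

theorem iteratedDerivWithin_bound (hc : 0 < c) (h : IsSymbolUpTo c N m a) :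
    HasZoneBound c (m + N) fun t ξ => iteratedDerivWithin N (fun τ => a τ ξ) (Ici 0) t := by
  induction N generalizing m a with
  | zero => simpa using h.1
  | succ N ih =>
    obtain ⟨-, b, hb, hb'⟩ := h
    obtain ⟨C, hC⟩ := ih hb'
    refine ⟨C, fun t ξ hz => ?_⟩
    beta_reduce
    rw [iteratedDerivWithin_succ']
    have e := iteratedDerivWithin_congr (n := N) (s := Ici (0 : ℝ)) (x := t)
      (f := derivWithin (fun τ => a τ ξ) (Ici 0)) (g := fun τ => b τ ξ)
      (fun t ht => (hb ξ (hz.ne_zero hc) t ht).derivWithin (uniqueDiffOn_Ici 0 t ht)) hz.1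
    rw [e]
    convert hC t ξ hz using 3
    push_cast; ring

end IsSymbolUpTo

theorem isScalarTimeSymbol_of_isSymbolUpTo {m : ℤ} {a : ℝ → Freq n → ℂ} (hc : 0 < c)
    (h : ∀ N, IsSymbolUpTo c N m a) : IsScalarTimeSymbol 0 m a := by
  refine ⟨fun ξ hξ => contDiffOn_infty.2 fun N => (h N).contDiffOn hξ, c, hc, fun k => ?_⟩
  obtain ⟨C, hC⟩ := (h k).iteratedDerivWithin_bound hc
  exact ⟨C, fun t ξ hz => by simpa using hC t ξ hz⟩

/-- The weight |ξ|^(−m₁) is constant in t and passes through every time derivative, which leaves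
estimates in powers of 1 + t alone. -/
theorem IsScalarTimeSymbol.exists_isSymbolUpTo {m₁ m₂ : ℤ} {a : ℝ → Freq n → ℂ}
    (h : IsScalarTimeSymbol m₁ m₂ a) :
    ∃ c₀ : ℝ, 0 < c₀ ∧ ∀ N, IsSymbolUpTo c₀ N m₂ fun t ξ => (‖ξ‖ ^ (-m₁) : ℝ) * a t ξ := by
  obtain ⟨hs, c₀, hc₀, hb⟩ := h
  refine ⟨c₀, hc₀, ?_⟩
  set g : ℕ → ℝ → Freq n → ℂ := fun k t ξ =>
    (‖ξ‖ ^ (-m₁) : ℝ) * iteratedDerivWithin k (fun τ => a τ ξ) (Ici 0) t with hg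
  have hbd : ∀ k : ℕ, HasZoneBound c₀ (m₂ + k) (g k) := fun k => by
    obtain ⟨C, hC⟩ := hb k
    refine ⟨C, fun t ξ hz => ?_⟩
    have hξ : 0 < ‖ξ‖ := norm_pos_iff.2 (hz.ne_zero hc₀)
    have h1 := hC t ξ hz
    simp only [hg, norm_mul, Complex.norm_real, Real.norm_eq_abs]
    rw [abs_of_pos (zpow_pos hξ _)]
    calc _ ≤ ‖ξ‖ ^ (-m₁) * (C * ‖ξ‖ ^ m₁ * (1 + t) ^ (-(m₂ + (k : ℤ)))) := by gcongr
      _ = (‖ξ‖ ^ (-m₁) * ‖ξ‖ ^ m₁) * (C * (1 + t) ^ (-(m₂ + (k : ℤ)))) := by ring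
      _ = _ := by rw [← zpow_add₀ hξ.ne', neg_add_cancel, zpow_zero, one_mul]
  have hd : ∀ k ξ, ξ ≠ 0 → ∀ t, 0 ≤ t →
      HasDerivWithinAt (fun τ => g k τ ξ) (g (k + 1) t ξ) (Ici 0) t := by
    intro k ξ hξ t ht
    have h1 := ((hs ξ hξ).differentiableOn_iteratedDerivWithin (m := k)
      (by exact_mod_cast WithTop.coe_lt_coe.2 (ENat.natCast_lt_top k)) (uniqueDiffOn_Ici 0) t ht)
    have h2 := h1.hasDerivWithinAt
    rw [← iteratedDerivWithin_succ] at h2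
    exact h2.const_mul _
  have key : ∀ N k : ℕ, IsSymbolUpTo c₀ N (m₂ + k) (g k) := by
    intro N
    induction N with
    | zero => exact fun k => ⟨hbd k, fun ξ hξ t ht => (hd k ξ hξ t ht).continuousWithinAt⟩
    | succ N ih =>
      refine fun k => ⟨hbd k, g (k + 1), hd k, ?_⟩
      have := ih (k + 1)
      push_cast at this
      rwa [← add_assoc] at this
  intro N
  simpa [hg] using key N 0

theorem IsScalarSymbol.isScalarTimeSymbol {m₁ m₂ : ℤ} {a : ℝ → Freq n → ℂ}
    (h : IsScalarSymbol m₁ m₂ a) : IsScalarTimeSymbol m₁ m₂ a := by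
  obtain ⟨hs, c₀, hc₀, hb⟩ := h
  refine ⟨fun ξ hξ => ?_, c₀, hc₀, fun k => ?_⟩
  · exact hs.comp (f := fun t : ℝ => (t, ξ)) (by fun_prop) fun t ht => ⟨ht, hξ⟩
  · obtain ⟨C, hC⟩ := hb k 0
    refine ⟨C, fun t ξ hz => ?_⟩
    have h1 := hC t ξ hz
    simp only [Nat.cast_zero, sub_zero] at h1
    refine le_trans (le_of_eq ?_) h1
    -- The zeroth Fréchet derivative is the function itself up to a linear isometry, which preserves
    -- the norms of the time derivatives.
    have e : (fun τ => iteratedFDeriv ℝ 0 (a τ) ξ)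
        = (continuousMultilinearCurryFin0 ℝ (Freq n) ℂ).symm ∘ fun τ => a τ ξ := by
      ext; simp
    rw [e, ← norm_iteratedFDerivWithin_eq_norm_iteratedDerivWithin,
      ← norm_iteratedFDerivWithin_eq_norm_iteratedDerivWithin,
      LinearIsometryEquiv.norm_iteratedFDerivWithin_comp_left _ _ (uniqueDiffOn_Ici 0) hz.1]

theorem IsSymbol.isTimeSymbol {d : ℕ} {m₁ m₂ : ℤ} {a : ℝ → Freq n → Mat d}
    (h : IsSymbol m₁ m₂ a) : IsTimeSymbol m₁ m₂ a :=
  fun i j => (h i j).isScalarTimeSymbol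

theorem IsTimeSymbol.exists_isSymbolUpTo {d : ℕ} {m₁ m₂ : ℤ} {a : ℝ → Freq n → Mat d}
    (h : IsTimeSymbol m₁ m₂ a) : ∃ c₀ : ℝ, 0 < c₀ ∧ ∀ N i j,
      IsSymbolUpTo c₀ N m₂ fun t ξ => (‖ξ‖ ^ (-m₁) : ℝ) * a t ξ i j := by
  choose c hc h using fun i j => (h i j).exists_isSymbolUpTo
  -- A zone constant above all those of the entries; the summand 1 keeps it positive even when d =
  -- 0.
  refine ⟨1 + ∑ i, ∑ j, c i j, ?_, fun N i j => (h i j N).mono_zone ?_⟩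
  · have : 0 ≤ ∑ i, ∑ j, c i j :=
      Finset.sum_nonneg fun i _ => Finset.sum_nonneg fun j _ => (hc i j).le
    positivity
  · have h1 := Finset.single_le_sum (f := fun i => ∑ j, c i j)
      (fun i _ => Finset.sum_nonneg fun j _ => (hc i j).le) (Finset.mem_univ i)
    have h2 := Finset.single_le_sum (f := fun j => c i j)
      (fun j _ => (hc i j).le) (Finset.mem_univ j)
    linarith

end TimeSymbols

end HypSys

namespace HypSys

open Set

/-! ### Change of unknowns in a linear system. -/

section Conjugation

variable {𝔸 : Type*} [NormedRing 𝔸] [CompleteSpace 𝔸]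

theorem hasDerivWithinAt_ringInverse [NormedAlgebra ℝ 𝔸] {G : ℝ → 𝔸} {G' : 𝔸} {s : Set ℝ} {t : ℝ}
    (hG : HasDerivWithinAt G G' s t) (hu : IsUnit (G t)) :
    HasDerivWithinAt (fun τ => Ring.inverse (G τ))
      (-(Ring.inverse (G t) * G' * Ring.inverse (G t))) s t := by
  obtain ⟨u, hu⟩ := hu
  have h := hasFDerivAt_ringInverse (𝕜 := ℝ) u
  rw [hu] at h
  refine (h.comp_hasDerivWithinAt t hG).congr_deriv ?_
  simp [← hu]

/-- The change of unknowns `X ↦ G⁻¹ X` in a linear system. -/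
theorem IsFundamentalPair.conj [NormedAlgebra ℝ 𝔸] {a : ℝ} {P X Y G G' : ℝ → 𝔸} (h : IsFundamentalPair a P X Y)
    (hG : ∀ t, a ≤ t → HasDerivWithinAt G (G' t) (Ici a) t)
    (hu : ∀ t, a ≤ t → IsUnit (G t)) :
    IsFundamentalPair a
      (fun t => Ring.inverse (G t) * P t * G t - Ring.inverse (G t) * G' t)
      (fun t => Ring.inverse (G t) * X t) (fun t => Y t * G t) where
  deriv_left t ht := by
    refine ((hasDerivWithinAt_ringInverse (hG t ht) (hu t ht)).mul
      (h.deriv_left t ht)).congr_deriv ?_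
    have e := Ring.mul_inverse_cancel _ (hu t ht)
    have e' : ∀ Z : 𝔸, G t * (Ring.inverse (G t) * Z) = Z := fun Z => by
      rw [← mul_assoc, e, one_mul]
    simp only [sub_mul, mul_assoc, neg_mul, e']
    abel
  deriv_right t ht := by
    refine ((h.deriv_right t ht).mul (hG t ht)).congr_deriv ?_
    have e := Ring.mul_inverse_cancel _ (hu t ht)
    have e' : ∀ Z : 𝔸, G t * (Ring.inverse (G t) * Z) = Z := fun Z => by
      rw [← mul_assoc, e, one_mul]
    simp only [mul_sub, mul_assoc, neg_mul, e']
    abel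
  right_mul_left t ht := by
    have e := Ring.mul_inverse_cancel _ (hu t ht)
    calc Y t * G t * (Ring.inverse (G t) * X t)
        = Y t * (G t * Ring.inverse (G t)) * X t := by simp only [mul_assoc]
      _ = 1 := by rw [e, mul_one, h.right_mul_left t ht]

/-- The commutator relation is chosen so that (D + R₀)(1 + N) = (1 + N)(D + F) + R₀N − NF. After
multiplication by the inverse U of 1 + N, the error contains only products of N with R₀ or F,
together with N'. -/
theorem conjugated_generator_eq {R : Type*} [Ring R] [Algebra ℂ R]
    {A A₁ M W M' W' N N' U R₀ F D : R} (hWM : W * M = 1)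
    (hU : U * (1 + N) = 1) (hd : W' * M + W * M' = 0)
    (hR : R₀ = W * (A - A₁) * M + (-Complex.I • W') * M) (hD : D = W * A₁ * M)
    (hN : D * N - N * D = F - R₀) :
    U * W * (Complex.I • A) * (M * (1 + N)) - U * W * (M' * (1 + N) + M * N')
      = Complex.I • (D + F) + U * (Complex.I • (R₀ * N - N * F) - N') := by
  have hI : ∀ x : R, Complex.I • (-Complex.I • x) = x := fun x => by
    rw [smul_smul]; simp
  have key : W * (Complex.I • A) * M - W * M' = Complex.I • (D + R₀) := by
    have : W' * M = -(W * M') := eq_neg_of_add_eq_zero_left hd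
    rw [hR, hD, smul_add, smul_add, smul_mul_assoc (-Complex.I), hI, this]
    simp only [mul_sub, sub_mul, smul_sub, mul_smul_comm, smul_mul_assoc]
    abel
  have e1 : U * W * (Complex.I • A) * (M * (1 + N)) - U * W * (M' * (1 + N) + M * N')
      = U * ((W * (Complex.I • A) * M - W * M') * (1 + N) - W * M * N') := by noncomm_ring
  have e2 : Complex.I • (D + F) = U * ((1 + N) * Complex.I • (D + F)) := by
    rw [← mul_assoc, hU, one_mul]
  have e3 : R₀ + D * N = F + N * D := by
    have := sub_eq_sub_iff_add_eq_add.1 hN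
    rw [add_comm, this, add_comm]
  rw [e1, key, hWM, one_mul, e2, ← mul_add]
  congr 1
  rw [smul_mul_assoc, mul_smul_comm, ← add_sub_assoc, ← smul_add]
  congr 2
  calc (D + R₀) * (1 + N) = D + (R₀ + D * N) + R₀ * N := by noncomm_ring
    _ = (1 + N) * (D + F) + (R₀ * N - N * F) := by rw [e3]; noncomm_ring

/-- The inverse satisfies U = 1 − NU, and ‖NU‖ ≤ ‖U‖/2 is absorbed on the left. The norm of 1 is
kept because it is not assumed to equal 1. -/
theorem norm_ringInverse_one_add_le {N : 𝔸} (hN : ‖N‖ ≤ 1 / 2) :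
    IsUnit (1 + N) ∧ ‖Ring.inverse (1 + N)‖ ≤ 2 * ‖(1 : 𝔸)‖ := by
  have hu : IsUnit (1 + N) := by
    have := isUnit_one_sub_of_norm_lt_one (x := -N) (by rw [norm_neg]; linarith)
    rwa [sub_neg_eq_add] at this
  refine ⟨hu, ?_⟩
  have e := Ring.mul_inverse_cancel _ hu
  set U := Ring.inverse (1 + N)
  have e2 : U = 1 - N * U := by rw [← e]; noncomm_ring
  have h1 : ‖U‖ ≤ ‖(1 : 𝔸)‖ + 1 / 2 * ‖U‖ := by
    calc ‖U‖ = ‖1 - N * U‖ := by rw [← e2]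
      _ ≤ ‖(1 : 𝔸)‖ + ‖N * U‖ := norm_sub_le _ _
      _ ≤ _ := by
        gcongr
        exact (norm_mul_le _ _).trans (by gcongr)
  linarith

end Conjugation

/-! ### Passing between matrices and their entries; similarity and eigenvalues. -/

section Matrices

variable {n d : ℕ}

theorem norm_le_sum_norm_entries (B : Mat d) : ‖B‖ ≤ ∑ i, ∑ j, ‖B i j‖ := by
  conv_lhs => rw [Matrix.matrix_eq_sum_single B]
  refine (norm_sum_le _ _).trans (Finset.sum_le_sum fun i _ => (norm_sum_le _ _).trans
    (Finset.sum_le_sum fun j _ => ?_))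
  rw [Matrix.linfty_opNorm_def]
  simp only [Matrix.single_apply]
  have : (0:ℝ) ≤ ‖B i j‖ := norm_nonneg _
  lift ‖B i j‖ to NNReal using this with b hb
  rw [NNReal.coe_le_coe]
  refine Finset.sup_le fun k _ => ?_
  rw [← NNReal.coe_le_coe, hb]
  push_cast
  by_cases hk : i = k
  · simp [hk, apply_ite]
  · simp [hk]

theorem norm_entry_le {α : Type*} [NormedRing α] (B : Matrix (Fin d) (Fin d) α) (i j : Fin d) :
    ‖B i j‖ ≤ ‖B‖ := by
  rw [Matrix.linfty_opNorm_def]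
  have h1 : ‖B i j‖₊ ≤ ∑ j, ‖B i j‖₊ :=
    Finset.single_le_sum (f := fun j => ‖B i j‖₊) (fun _ _ => zero_le) (Finset.mem_univ j)
  have h2 := Finset.le_sup (f := fun i => ∑ j, ‖B i j‖₊) (Finset.mem_univ i)
  exact_mod_cast h1.trans h2

theorem roots_prod_X_sub_C_univ (f : Fin d → ℂ) :
    (∏ j, (Polynomial.X - Polynomial.C (f j))).roots = Finset.univ.val.map f := by
  rw [← Polynomial.roots_multiset_prod_X_sub_C (Finset.univ.val.map f), Multiset.map_map]
  rfl

/-- The diagonal entries of a diagonal matrix similar to `B` are the eigenvalues of `B`. -/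
theorem exists_diag_eq_of_charpoly_eq {B M : Mat d} (hM : IsUnit M)
    (hdiag : (M⁻¹ * B * M).IsDiag) {ev : Fin d → ℝ}
    (hev : B.charpoly = ∏ j, (Polynomial.X - Polynomial.C ((ev j : ℝ) : ℂ)))
    (hinj : Function.Injective ev) :
    ∃ σ : Fin d → Fin d, Function.Injective σ ∧ ∀ i, (M⁻¹ * B * M) i i = ev (σ i) := by
  have h1 : (M⁻¹ * B * M).charpoly = B.charpoly := by
    rw [Matrix.charpoly_mul_comm, ← mul_assoc,
      Matrix.mul_nonsing_inv _ ((Matrix.isUnit_iff_isUnit_det M).1 hM), one_mul]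
  obtain ⟨δ, hδ⟩ : ∃ δ : Fin d → ℂ, M⁻¹ * B * M = Matrix.diagonal δ :=
    ⟨_, hdiag.diagonal_diag.symm⟩
  rw [hδ, Matrix.charpoly_diagonal, hev] at h1
  simp only [hδ, Matrix.diagonal_apply_eq]
  have h2 : Finset.univ.val.map δ = Finset.univ.val.map fun j => ((ev j : ℝ) : ℂ) := by
    rw [← roots_prod_X_sub_C_univ, ← roots_prod_X_sub_C_univ, h1]
  have h3 : ∀ i, ∃ j, δ i = ev j := fun i => by
    have : δ i ∈ Finset.univ.val.map δ := Multiset.mem_map_of_mem _ (Finset.mem_univ_val i)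
    rw [h2, Multiset.mem_map] at this
    obtain ⟨j, -, hj⟩ := this
    exact ⟨j, hj.symm⟩
  have h4 : Function.Injective δ := by
    have hnd : (Finset.univ.val.map fun j => ((ev j : ℝ) : ℂ)).Nodup :=
      Finset.univ.nodup.map fun i j hij => hinj (by exact_mod_cast hij)
    rw [← h2] at hnd
    exact fun i j hij => Multiset.inj_on_of_nodup_map hnd i (Finset.mem_univ_val i) j
      (Finset.mem_univ_val j) hij
  choose σ hσ using h3
  refine ⟨σ, fun i j hij => h4 ?_, hσ⟩
  rw [hσ, hσ, hij]

variable {c : ℝ}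

theorem IsSymbolUpTo.matrix_mul {N : ℕ} {m m' : ℤ} {a b : ℝ → Freq n → Mat d}
    (ha : ∀ i j, IsSymbolUpTo c N m fun t ξ => a t ξ i j)
    (hb : ∀ i j, IsSymbolUpTo c N m' fun t ξ => b t ξ i j) (i j : Fin d) :
    IsSymbolUpTo c N (m + m') fun t ξ => (a t ξ * b t ξ) i j := by
  simp only [Matrix.mul_apply]
  exact IsSymbolUpTo.sum _ fun k _ => (ha i k).mul (hb k j)

theorem IsSymbolUpTo.derivWithin_time {N : ℕ} {m : ℤ} {a : ℝ → Freq n → ℂ} (hc : 0 < c)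
    (h : IsSymbolUpTo c (N + 1) m a) :
    IsSymbolUpTo c N (m + 1) fun t ξ => derivWithin (fun τ => a τ ξ) (Ici 0) t := by
  obtain ⟨-, b, hb, hb'⟩ := h
  exact hb'.congr hc fun ξ hξ t ht => (hb ξ hξ t ht).derivWithin (uniqueDiffOn_Ici 0 t ht)

theorem IsSymbolUpTo.hasDerivWithinAt {N : ℕ} {m : ℤ} {a : ℝ → Freq n → ℂ}
    (h : IsSymbolUpTo c (N + 1) m a) {ξ : Freq n} (hξ : ξ ≠ 0) {t : ℝ} (ht : 0 ≤ t) :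
    HasDerivWithinAt (fun τ => a τ ξ) (derivWithin (fun τ => a τ ξ) (Ici 0) t) (Ici 0) t := by
  obtain ⟨-, b, hb, -⟩ := h
  exact (hb ξ hξ t ht).differentiableWithinAt.hasDerivWithinAt

theorem exists_norm_le_of_isSymbolUpTo {N : ℕ} {m : ℤ} {a : ℝ → Freq n → Mat d}
    (ha : ∀ i j, IsSymbolUpTo c N m fun t ξ => a t ξ i j) :
    ∃ K : ℝ, 0 ≤ K ∧ ∀ t ξ, InZone c t ξ → ‖a t ξ‖ ≤ K * (1 + t) ^ (-m) := by
  choose K hK h using fun i j => (ha i j).bound.exists_nonneg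
  refine ⟨∑ i, ∑ j, K i j, Finset.sum_nonneg fun i _ => Finset.sum_nonneg fun j _ => hK i j,
    fun t ξ hz => ?_⟩
  refine (norm_le_sum_norm_entries _).trans ?_
  simp only [Finset.sum_mul]
  exact Finset.sum_le_sum fun i _ => Finset.sum_le_sum fun j _ => h i j t ξ hz

theorem hasDerivWithinAt_of_entries {a : ℝ → Mat d} {a' : Mat d} {s : Set ℝ} {t : ℝ}
    (h : ∀ i j, HasDerivWithinAt (fun τ => a τ i j) (a' i j) s t) : HasDerivWithinAt a a' s t :=
  hasDerivWithinAt_pi.2 fun i => hasDerivWithinAt_pi.2 (h i)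

theorem hasDerivWithinAt_entry {a : ℝ → Mat d} {a' : Mat d} {s : Set ℝ} {t : ℝ}
    (h : HasDerivWithinAt a a' s t) (i j : Fin d) :
    HasDerivWithinAt (fun τ => a τ i j) (a' i j) s t :=
  hasDerivWithinAt_pi.1 (hasDerivWithinAt_pi.1 h i) j

/-- A fundamental solution is given by any fundamental pair. -/
theorem IsFundamentalSolution.eq_mul {A : ℝ → Freq n → Mat d} {E : ℝ → ℝ → Freq n → Mat d}
    (hE : IsFundamentalSolution A E) {ξ : Freq n} (hξ : ξ ≠ 0) {X Y : ℝ → Mat d}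
    (h : IsFundamentalPair 0 (fun t => Complex.I • A t ξ) X Y) {s t : ℝ} (hs : 0 ≤ s)
    (ht : 0 ≤ t) : E t s ξ = X t * Y s := by
  obtain ⟨hE1, hE2⟩ := hE ξ hξ s hs
  have hd : ∀ t, 0 ≤ t → HasDerivWithinAt (fun τ => E τ s ξ)
      (Complex.I • A t ξ * E t s ξ) (Ici 0) t := fun t ht =>
    hasDerivWithinAt_of_entries fun i j => by
      simpa using hE2 t ht i j
  have := eq_of_hasDerivWithinAt_zero (f := fun τ => Y τ * E τ s ξ) (a := 0) (fun t ht =>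
    ((h.deriv_right t ht).mul (hd t ht)).congr_deriv (by simp only [neg_mul, mul_assoc]; abel))
    hs ht
  simp only [hE1, mul_one] at this
  rw [← this, ← mul_assoc, h.left_mul_right ht, one_mul]

end Matrices

end HypSys

namespace HypSys

open Set

/-! ### The second diagonalisation step in the zone. -/

section Diagonalisation

variable {n d : ℕ} {A A₁ M : ℝ → Freq n → Mat d}

/-- The diagonal coefficients of `M⁻¹ A₁ M + F⁽⁰⁾`. -/
noncomputable def diagCoeff (A A₁ M : ℝ → Freq n → Mat d) (t : ℝ) (ξ : Freq n) (j : Fin d) : ℂ :=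
  ((M t ξ)⁻¹ * A₁ t ξ * M t ξ) j j + R₀ A A₁ M t ξ j j

theorem IsDiagonaliser.exists_eigenvalues (hA : IsUniformlyStrictlyHyperbolic A A₁)
    {S : (ℝ → Freq n → Mat d) → Prop} (hM : IsDiagonaliser S A₁ M) :
    ∃ κ : ℝ, 0 < κ ∧ ∀ t, 0 ≤ t → ∀ ξ, ξ ≠ 0 → ∃ μ : Fin d → ℝ,
      (∀ i, ((M t ξ)⁻¹ * A₁ t ξ * M t ξ) i i = μ i) ∧
        ∀ i j, i ≠ j → κ * ‖ξ‖ ≤ |μ i - μ j| := by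
  obtain ⟨κ, hκ, hev⟩ := hA.eigenvalues
  refine ⟨κ, hκ, fun t ht ξ hξ => ?_⟩
  obtain ⟨ev, hch, hsep⟩ := hev t ht ξ hξ
  have hinj : Function.Injective ev := fun i j hij => by
    by_contra h
    have := hsep i j h
    rw [hij, sub_self, abs_zero] at this
    have : 0 < κ * ‖ξ‖ := mul_pos hκ (norm_pos_iff.2 hξ)
    linarith
  obtain ⟨σ, hσ, hσ'⟩ := exists_diag_eq_of_charpoly_eq (hM.isUnit t ht ξ hξ)
    (hM.isDiag t ht ξ hξ) hch hinj
  exact ⟨fun i => ev (σ i), hσ', fun i j hij => hsep _ _ (hσ.ne hij)⟩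

/-- The symbol estimates for a diagonaliser, with a common zone. -/
theorem IsDiagonaliser.exists_symbolUpTo (hA : IsUniformlyStrictlyHyperbolic A A₁)
    (hM : IsDiagonaliser (IsTimeSymbol 0 0) A₁ M) :
    ∃ c : ℝ, 0 < c ∧ (∀ N i j, IsSymbolUpTo c N 0 fun t ξ => M t ξ i j) ∧
      (∀ N i j, IsSymbolUpTo c N 0 fun t ξ => (M t ξ)⁻¹ i j) ∧
      (∀ N i j, IsSymbolUpTo c N 1 fun t ξ => R₀ A A₁ M t ξ i j) ∧
      ∀ N i j, IsSymbolUpTo c N 0 fun t ξ =>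
        ((‖ξ‖⁻¹ : ℝ) : ℂ) * ((M t ξ)⁻¹ * A₁ t ξ * M t ξ) i j := by
  obtain ⟨c₁, hc₁, h₁⟩ := hM.symbol.exists_isSymbolUpTo
  obtain ⟨c₂, hc₂, h₂⟩ := hM.symbol_inv.exists_isSymbolUpTo
  obtain ⟨c₃, hc₃, h₃⟩ := hA.principal_symbol.isTimeSymbol.exists_isSymbolUpTo
  obtain ⟨c₄, hc₄, h₄⟩ := hA.lower_order.isTimeSymbol.exists_isSymbolUpTo
  set c := c₁ + c₂ + c₃ + c₄ with hc
  have hc0 : 0 < c := by positivity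
  have k₁ : ∀ N i j, IsSymbolUpTo c N 0 fun t ξ => M t ξ i j := fun N i j => by
    simpa using (h₁ N i j).mono_zone (show c₁ ≤ c by linarith)
  have k₂ : ∀ N i j, IsSymbolUpTo c N 0 fun t ξ => (M t ξ)⁻¹ i j := fun N i j => by
    simpa using (h₂ N i j).mono_zone (show c₂ ≤ c by linarith)
  have k₃ : ∀ N i j, IsSymbolUpTo c N 0 fun t ξ => ((‖ξ‖⁻¹ : ℝ) : ℂ) * A₁ t ξ i j :=
    fun N i j => by simpa using (h₃ N i j).mono_zone (show c₃ ≤ c by linarith)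
  have k₄ : ∀ N i j, IsSymbolUpTo c N 1 fun t ξ => (A t ξ - A₁ t ξ) i j := fun N i j => by
    simpa using (h₄ N i j).mono_zone (show c₄ ≤ c by linarith)
  refine ⟨c, hc0, k₁, k₂, fun N i j => ?_, fun N i j => ?_⟩
  · have e1 := IsSymbolUpTo.matrix_mul (IsSymbolUpTo.matrix_mul (k₂ N) (k₄ N)) (k₁ N) i j
    have hDt : ∀ i j, IsSymbolUpTo c N 1 fun t ξ => Dt (fun τ η => (M τ η)⁻¹) t ξ i j :=
      fun i j => by
        have := ((k₂ (N + 1) i j).derivWithin_time hc0).const_mul (-Complex.I)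
        rw [zero_add] at this
        exact this
    have e2 := IsSymbolUpTo.matrix_mul hDt (k₁ N) i j
    simp only [zero_add, add_zero] at e1 e2
    exact e1.add e2
  · have k₃' : ∀ i j, IsSymbolUpTo c N 0 fun t ξ => (((‖ξ‖⁻¹ : ℝ) : ℂ) • A₁ t ξ) i j := k₃ N
    have := IsSymbolUpTo.matrix_mul (IsSymbolUpTo.matrix_mul (k₂ N) k₃') (k₁ N) i j
    simpa [Matrix.mul_smul, Matrix.smul_mul] using this

/-- Collects the orders of the error: with x = |ξ| and τ = 1 + t, the products R₀N and NF and the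
derivative N' all have size x⁻¹τ⁻². -/
theorem remainder_le {u r f b b' e k₁ k₂ k₃ k₄ x τ : ℝ} (hu : 0 ≤ u) (hr : 0 ≤ r) (hf : 0 ≤ f)
    (hb : 0 ≤ b) (hb' : 0 ≤ b') (hx : 0 < x) (hτ : 0 < τ) (h₀ : u ≤ e) (h₁ : r ≤ k₁ / τ)
    (h₂ : f ≤ k₂ / τ) (h₃ : b ≤ k₃ / (x * τ)) (h₄ : b' ≤ k₄ / (x * τ ^ 2)) :
    u * (r * b + b * f + b') ≤ e * (k₁ * k₃ + k₃ * k₂ + k₄) / x / τ ^ 2 := by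
  have h5 := mul_le_mul h₁ h₃ hb (hr.trans h₁)
  have h6 := mul_le_mul h₃ h₂ hf (hb.trans h₃)
  refine (mul_le_mul h₀ (add_le_add (add_le_add h5 h6) h₄) (by positivity)
    (hu.trans h₀)).trans (le_of_eq ?_)
  field_simp

/-- Elimination of the off-diagonal part of `R₀` in the zone. -/
theorem IsDiagonaliser.exists_transform (hA : IsUniformlyStrictlyHyperbolic A A₁)
    (hM : IsDiagonaliser (IsTimeSymbol 0 0) A₁ M) :
    ∃ c₀ : ℝ, 0 < c₀ ∧ ∃ K : ℝ, 0 ≤ K ∧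
      (∀ ξ, ξ ≠ 0 → ∀ j, ContinuousOn (fun t => diagCoeff A A₁ M t ξ j) (Ici 0)) ∧
      ∀ ξ a, InZone c₀ a ξ → ∃ G H : ℝ → Mat d,
        (∀ t, a ≤ t → ‖G t‖ ≤ K ∧ ‖H t‖ ≤ K ∧ G t * H t = 1) ∧
        ∀ X Y, IsFundamentalPair a (fun t => Complex.I • A t ξ) X Y →
          ∃ Q, IsFundamentalPair a Q (fun t => H t * X t) (fun t => Y t * G t) ∧
            ∀ t, a ≤ t →
              ‖Q t - Matrix.diagonal fun j => Complex.I * diagCoeff A A₁ M t ξ j‖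
                ≤ K / ‖ξ‖ / (1 + t) ^ 2 := by
  obtain ⟨κ, hκ, hμ⟩ := hM.exists_eigenvalues hA
  obtain ⟨c, hc, hM₁, hW, hR, hD⟩ := hM.exists_symbolUpTo hA
  set D : ℝ → Freq n → Mat d := fun t ξ => (M t ξ)⁻¹ * A₁ t ξ * M t ξ with hDdef
  -- N = |ξ|⁻¹B has off-diagonal entries −R₀,ᵢⱼ/(μᵢ − μⱼ), μᵢ being the diagonal entries of D, and
  -- thus solves [D, N] = F⁽⁰⁾ − R₀. Dividing by the normalised gaps, which stay above κ, makes B a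
  -- symbol of order {0, 1}.
  set B : ℝ → Freq n → Mat d := fun t ξ => Matrix.of fun i j => if i = j then 0 else
    -(R₀ A A₁ M t ξ i j * (((‖ξ‖⁻¹ : ℝ) : ℂ) * D t ξ i i - ((‖ξ‖⁻¹ : ℝ) : ℂ) * D t ξ j j)⁻¹)
    with hB
  have hgap : ∀ i j, i ≠ j → ∀ ξ, ξ ≠ 0 → ∀ t, 0 ≤ t →
      κ ≤ ‖((‖ξ‖⁻¹ : ℝ) : ℂ) * D t ξ i i - ((‖ξ‖⁻¹ : ℝ) : ℂ) * D t ξ j j‖ := by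
    intro i j hij ξ hξ t ht
    obtain ⟨μ, h1, h2⟩ := hμ t ht ξ hξ
    have h3 := h2 i j hij
    have hpos : 0 < ‖ξ‖ := norm_pos_iff.2 hξ
    simp only [hDdef]
    rw [h1, h1, ← mul_sub, ← Complex.ofReal_sub, ← Complex.ofReal_mul, Complex.norm_real,
      Real.norm_eq_abs, abs_mul, abs_of_pos (inv_pos.2 hpos), ← div_eq_inv_mul,
      le_div_iff₀ hpos]
    exact h3
  have hBs : ∀ N i j, IsSymbolUpTo c N 1 fun t ξ => B t ξ i j := by
    intro N i j
    by_cases hij : i = j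
    · simpa [hB, hij] using (IsSymbolUpTo.zero : IsSymbolUpTo (n := n) c N 1 _)
    · have h1 := ((hD N i i).sub (hD N j j)).inv hκ (fun ξ hξ t ht h0 => by
        have := hgap i j hij ξ hξ t ht
        simp only [hDdef] at this
        rw [h0, norm_zero] at this
        linarith) (fun t ξ hz => hgap i j hij ξ (hz.ne_zero hc) t hz.1)
      have h2 := ((hR N i j).mul h1).neg
      simpa [hB, hij] using h2
  set B' : ℝ → Freq n → Mat d := fun t ξ => Matrix.of fun i j =>
    derivWithin (fun τ => B τ ξ i j) (Ici 0) t with hB'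
  set M' : ℝ → Freq n → Mat d := fun t ξ => Matrix.of fun i j =>
    derivWithin (fun τ => M τ ξ i j) (Ici 0) t with hM'
  set W' : ℝ → Freq n → Mat d := fun t ξ => Matrix.of fun i j =>
    derivWithin (fun τ => (M τ ξ)⁻¹ i j) (Ici 0) t with hW'
  have hBs' : ∀ i j, IsSymbolUpTo c 0 2 fun t ξ => B' t ξ i j := fun i j =>
    (hBs 1 i j).derivWithin_time hc
  have hF : ∀ i j, IsSymbolUpTo c 0 1 fun t ξ => F₀ A A₁ M t ξ i j := by
    intro i j
    by_cases hij : i = j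
    · subst hij
      simpa [F₀] using hR 0 i i
    · simpa [F₀, hij] using (IsSymbolUpTo.zero : IsSymbolUpTo (n := n) c 0 1 _)
  obtain ⟨KM, hKM, bM⟩ := exists_norm_le_of_isSymbolUpTo (hM₁ 0)
  obtain ⟨KW, hKW, bW⟩ := exists_norm_le_of_isSymbolUpTo (hW 0)
  obtain ⟨KR, hKR, bR⟩ := exists_norm_le_of_isSymbolUpTo (hR 0)
  obtain ⟨KF, hKF, bF⟩ := exists_norm_le_of_isSymbolUpTo hF
  obtain ⟨KB, hKB, bB⟩ := exists_norm_le_of_isSymbolUpTo (hBs 0)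
  obtain ⟨KB', hKB', bB'⟩ := exists_norm_le_of_isSymbolUpTo hBs'
  set e₁ := ‖(1 : Mat d)‖ with he₁
  have he₁0 : 0 ≤ e₁ := norm_nonneg _
  have hK₁ : 0 ≤ KM * (e₁ + 1 / 2) := by positivity
  have hK₂ : 0 ≤ 2 * e₁ * KW := by positivity
  have hK₃ : 0 ≤ 2 * e₁ * (KR * KB + KB * KF + KB') := by positivity
  -- In the zone (1 + t)|ξ| ≥ c + 2·KB the bound ‖N‖ ≤ KB/(|ξ|(1 + t)) is at most 1/2, so 1 + N is
  -- invertible there.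
  refine ⟨c + 2 * KB, by positivity,
    KM * (e₁ + 1 / 2) + 2 * e₁ * KW + 2 * e₁ * (KR * KB + KB * KF + KB'), by positivity,
    fun ξ hξ j => ?_, fun ξ a hza => ?_⟩
  · have h1 := ((hD 0 j j).continuousOn hξ).const_smul ((‖ξ‖ : ℝ) : ℂ)
    have hξ' : ((‖ξ‖ : ℝ) : ℂ) ≠ 0 := by exact_mod_cast (norm_pos_iff.2 hξ).ne'
    refine (h1.add ((hR 0 j j).continuousOn hξ)).congr fun t _ => ?_
    simp [diagCoeff, hξ']
  have hc' : 0 < c + 2 * KB := by positivity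
  have hξ : ξ ≠ 0 := hza.ne_zero hc'
  have hξp : 0 < ‖ξ‖ := norm_pos_iff.2 hξ
  have ha0 : 0 ≤ a := hza.1
  have hzt : ∀ t, a ≤ t → InZone c t ξ := fun t ht =>
    (hza.of_time_le ht).of_le (by linarith)
  set ρ : ℂ := ((‖ξ‖⁻¹ : ℝ) : ℂ) with hρ
  have hρn : ‖ρ‖ = ‖ξ‖⁻¹ := by
    rw [hρ, Complex.norm_real, Real.norm_eq_abs, abs_of_pos (inv_pos.2 hξp)]
  have hNle : ∀ t, a ≤ t → ‖ρ • B t ξ‖ ≤ KB / (‖ξ‖ * (1 + t)) := fun t ht => by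
    have h1 := bB t ξ (hzt t ht)
    have h2 := (hzt t ht).one_add_pos
    rw [norm_smul, hρn]
    calc _ ≤ ‖ξ‖⁻¹ * (KB * (1 + t) ^ (-1 : ℤ)) := by gcongr
      _ = _ := by rw [zpow_neg_one]; field_simp
  have hN'le : ∀ t, a ≤ t → ‖ρ • B' t ξ‖ ≤ KB' / (‖ξ‖ * (1 + t) ^ 2) := fun t ht => by
    have h1 := bB' t ξ (hzt t ht)
    have h2 := (hzt t ht).one_add_pos
    rw [norm_smul, hρn]
    calc _ ≤ ‖ξ‖⁻¹ * (KB' * (1 + t) ^ (-2 : ℤ)) := by gcongr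
      _ = _ := by rw [zpow_neg]; norm_cast; field_simp
  have hNhalf : ∀ t, a ≤ t → ‖ρ • B t ξ‖ ≤ 1 / 2 := fun t ht => by
    refine (hNle t ht).trans ?_
    have h2 := (hzt t ht).one_add_pos
    have h3 := (hza.of_time_le ht).2
    rw [div_le_iff₀ (by positivity)]
    linarith
  have hU := fun t ht => norm_ringInverse_one_add_le (hNhalf t ht)
  have hdet : ∀ t, a ≤ t → IsUnit (M t ξ).det := fun t ht =>
    (Matrix.isUnit_iff_isUnit_det _).1 (hM.isUnit t (ha0.trans ht) ξ hξ)
  have hWM : ∀ t, a ≤ t → (M t ξ)⁻¹ * M t ξ = 1 := fun t ht =>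
    Matrix.nonsing_inv_mul _ (hdet t ht)
  have hMW : ∀ t, a ≤ t → M t ξ * (M t ξ)⁻¹ = 1 := fun t ht =>
    Matrix.mul_nonsing_inv _ (hdet t ht)
  set U : ℝ → Mat d := fun t => Ring.inverse (1 + ρ • B t ξ) with hUdef
  have hU1 : ∀ t, a ≤ t → U t * (1 + ρ • B t ξ) = 1 := fun t ht =>
    Ring.inverse_mul_cancel _ (hU t ht).1
  have hU2 : ∀ t, a ≤ t → (1 + ρ • B t ξ) * U t = 1 := fun t ht =>
    Ring.mul_inverse_cancel _ (hU t ht).1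
  set G : ℝ → Mat d := fun t => M t ξ * (1 + ρ • B t ξ) with hG
  have hGH : ∀ t, a ≤ t → G t * (U t * (M t ξ)⁻¹) = 1 := fun t ht => by
    calc G t * (U t * (M t ξ)⁻¹)
        = M t ξ * ((1 + ρ • B t ξ) * U t) * (M t ξ)⁻¹ := by simp only [hG, mul_assoc]
      _ = 1 := by rw [hU2 t ht, mul_one, hMW t ht]
  have hHG : ∀ t, a ≤ t → U t * (M t ξ)⁻¹ * G t = 1 := fun t ht =>
    mul_eq_one_comm.1 (hGH t ht)
  have hGu : ∀ t, a ≤ t → IsUnit (G t) := fun t ht =>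
    ⟨⟨G t, _, hGH t ht, hHG t ht⟩, rfl⟩
  have hH : ∀ t, a ≤ t → Ring.inverse (G t) = U t * (M t ξ)⁻¹ := fun t ht =>
    left_inv_eq_right_inv (Ring.inverse_mul_cancel _ (hGu t ht)) (hGH t ht)
  have dM : ∀ t, a ≤ t → HasDerivWithinAt (fun t => M t ξ) (M' t ξ) (Ici a) t := fun t ht =>
    (hasDerivWithinAt_of_entries fun i j =>
      (hM₁ 1 i j).hasDerivWithinAt hξ (ha0.trans ht)).mono (Ici_subset_Ici.2 ha0)
  have dW : ∀ t, a ≤ t → HasDerivWithinAt (fun t => (M t ξ)⁻¹) (W' t ξ) (Ici a) t :=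
    fun t ht => (hasDerivWithinAt_of_entries fun i j =>
      (hW 1 i j).hasDerivWithinAt hξ (ha0.trans ht)).mono (Ici_subset_Ici.2 ha0)
  have dB : ∀ t, a ≤ t → HasDerivWithinAt (fun t => B t ξ) (B' t ξ) (Ici a) t :=
    fun t ht => (hasDerivWithinAt_of_entries fun i j =>
      (hBs 1 i j).hasDerivWithinAt hξ (ha0.trans ht)).mono (Ici_subset_Ici.2 ha0)
  have dG : ∀ t, a ≤ t → HasDerivWithinAt G
      (M' t ξ * (1 + ρ • B t ξ) + M t ξ * (ρ • B' t ξ)) (Ici a) t := fun t ht =>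
    (dM t ht).mul (((dB t ht).const_smul ρ).const_add 1)
  -- Differentiating M⁻¹M = 1 relates M' to the derivative of M⁻¹ occurring in R₀.
  have hWM' : ∀ t, a ≤ t → W' t ξ * M t ξ + (M t ξ)⁻¹ * M' t ξ = 0 := fun t ht => by
    have h1 := (dW t ht).mul (dM t ht)
    have h2 : HasDerivWithinAt (fun t => (M t ξ)⁻¹ * M t ξ) 0 (Ici a) t :=
      (hasDerivWithinAt_const t (Ici a) (1 : Mat d)).congr (fun τ hτ => hWM τ hτ) (hWM t ht)
    exact (uniqueDiffOn_Ici a t ht).eq_deriv _ h1 h2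
  refine ⟨G, fun t => Ring.inverse (G t), fun t ht => ⟨?_, ?_, ?_⟩, fun X Y hXY =>
    ⟨_, hXY.conj dG hGu, fun t ht => ?_⟩⟩
  · have h1 := bM t ξ (hzt t ht)
    rw [neg_zero, zpow_zero, mul_one] at h1
    calc ‖G t‖ ≤ ‖M t ξ‖ * ‖1 + ρ • B t ξ‖ := norm_mul_le _ _
      _ ≤ KM * (e₁ + 1 / 2) := by
        gcongr
        exact (norm_add_le _ _).trans (by gcongr; exact hNhalf t ht)
      _ ≤ _ := by linarith
  · have h1 := bW t ξ (hzt t ht)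
    rw [neg_zero, zpow_zero, mul_one] at h1
    beta_reduce
    rw [hH t ht]
    calc ‖U t * (M t ξ)⁻¹‖ ≤ ‖U t‖ * ‖(M t ξ)⁻¹‖ := norm_mul_le _ _
      _ ≤ 2 * e₁ * KW := by
        gcongr
        exact (hU t ht).2
      _ ≤ _ := by linarith
  · exact Ring.mul_inverse_cancel _ (hGu t ht)
  · have hdiag : (Matrix.diagonal fun j => Complex.I * diagCoeff A A₁ M t ξ j)
        = Complex.I • (D t ξ + F₀ A A₁ M t ξ) := by
      have h1 : D t ξ = Matrix.diagonal fun j => D t ξ j j :=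
        (hM.isDiag t (ha0.trans ht) ξ hξ).diagonal_diag.symm
      rw [h1, F₀, Matrix.diagonal_add, ← Matrix.diagonal_smul]
      rfl
    have hcomm : D t ξ * (ρ • B t ξ) - (ρ • B t ξ) * D t ξ
        = F₀ A A₁ M t ξ - R₀ A A₁ M t ξ := by
      have h1 : D t ξ = Matrix.diagonal fun j => D t ξ j j :=
        (hM.isDiag t (ha0.trans ht) ξ hξ).diagonal_diag.symm
      ext i j
      rw [h1, Matrix.sub_apply, Matrix.diagonal_mul, Matrix.mul_diagonal, Matrix.sub_apply]
      by_cases hij : i = j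
      · subst hij
        simp [F₀, hB]
      · have h2 := hgap i j hij ξ hξ t (ha0.trans ht)
        have h3 : ρ * D t ξ i i - ρ * D t ξ j j ≠ 0 := fun h0 => by
          rw [h0, norm_zero] at h2
          linarith
        have h4 : (ρ • B t ξ) i j
            = ρ * -(R₀ A A₁ M t ξ i j * (ρ * D t ξ i i - ρ * D t ξ j j)⁻¹) := by
          simp [hB, hij, hρ]
        have h5 : F₀ A A₁ M t ξ i j = 0 := by simp [F₀, hij]
        rw [h4, h5]
        linear_combination (-R₀ A A₁ M t ξ i j) * mul_inv_cancel₀ h3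
    have key := conjugated_generator_eq (A := A t ξ) (A₁ := A₁ t ξ) (M := M t ξ)
      (W := (M t ξ)⁻¹) (M' := M' t ξ) (W' := W' t ξ) (N := ρ • B t ξ) (N' := ρ • B' t ξ)
      (U := U t) (R₀ := R₀ A A₁ M t ξ) (F := F₀ A A₁ M t ξ) (D := D t ξ) (hWM t ht) (hU1 t ht)
      (hWM' t ht) rfl rfl hcomm
    rw [hH t ht]
    simp only [hG]
    rw [key, hdiag, add_sub_cancel_left]
    have h1t := (hzt t ht).one_add_pos
    have r1 : ‖R₀ A A₁ M t ξ‖ ≤ KR / (1 + t) := by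
      simpa [zpow_neg_one, div_eq_mul_inv] using bR t ξ (hzt t ht)
    have r2 : ‖F₀ A A₁ M t ξ‖ ≤ KF / (1 + t) := by
      simpa [zpow_neg_one, div_eq_mul_inv] using bF t ξ (hzt t ht)
    have r3 := hNle t ht
    have r4 := hN'le t ht
    calc ‖U t * (Complex.I • (R₀ A A₁ M t ξ * (ρ • B t ξ) - ρ • B t ξ * F₀ A A₁ M t ξ)
            - ρ • B' t ξ)‖
        ≤ ‖U t‖ * (‖R₀ A A₁ M t ξ‖ * ‖ρ • B t ξ‖ + ‖ρ • B t ξ‖ * ‖F₀ A A₁ M t ξ‖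
            + ‖ρ • B' t ξ‖) := by
          refine (norm_mul_le _ _).trans (mul_le_mul_of_nonneg_left ?_ (norm_nonneg _))
          refine (norm_sub_le _ _).trans (add_le_add ?_ le_rfl)
          rw [norm_smul, Complex.norm_I, one_mul]
          exact (norm_sub_le _ _).trans (add_le_add (norm_mul_le _ _) (norm_mul_le _ _))
      _ ≤ 2 * e₁ * (KR * KB + KB * KF + KB') / ‖ξ‖ / (1 + t) ^ 2 :=
          remainder_le (norm_nonneg _) (norm_nonneg _) (norm_nonneg _) (norm_nonneg _)
            (norm_nonneg _) hξp h1t (hU t ht).2 r1 r2 r3 r4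
      _ ≤ _ := by
          gcongr
          linarith

end Diagonalisation

end HypSys

namespace HypSys

open Set

/-! ### Comparison with the diagonal system and the equivalence. -/

section Equivalence

variable {n d : ℕ} {A A₁ M : ℝ → Freq n → Mat d}

/-- Diagonal matrices commute, so the system decouples into scalar equations solved by exponentials
of primitives. -/
theorem exists_isFundamentalPair_diagonal {Λ : ℝ → Fin d → ℂ}
    (hΛ : ∀ j, ContinuousOn (fun t => Λ t j) (Ici 0)) :
    ∃ X Y : ℝ → Mat d,
      IsFundamentalPair 0 (fun t => Matrix.diagonal fun j => Complex.I * Λ t j) X Y ∧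
      ∀ s t, 0 ≤ s → 0 ≤ t → X t * Y s =
        Matrix.diagonal fun j => Complex.exp (Complex.I * ∫ τ in s..t, Λ τ j) := by
  have hc : ∀ j, Continuous fun t => Λ (max t 0) j := fun j =>
    (hΛ j).comp_continuous (by fun_prop) fun t => le_max_right t 0
  set φ : Fin d → ℝ → ℂ := fun j t => ∫ τ in (0 : ℝ)..t, Λ (max τ 0) j with hφ
  have hφ' : ∀ j t, 0 ≤ t → HasDerivWithinAt (φ j) (Λ t j) (Ici 0) t := fun j t ht => by
    have := intervalIntegral.integral_hasDerivAt_right ((hc j).intervalIntegrable 0 t)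
      ((hc j).stronglyMeasurableAtFilter _ _) (hc j).continuousAt
    simpa [max_eq_left ht] using this.hasDerivWithinAt
  have hdiag : ∀ {f : ℝ → Fin d → ℂ} {f' : Fin d → ℂ} {t : ℝ},
      (∀ j, HasDerivWithinAt (fun τ => f τ j) (f' j) (Ici 0) t) →
      HasDerivWithinAt (fun τ => Matrix.diagonal (f τ)) (Matrix.diagonal f') (Ici 0) t := by
    intro f f' t h
    refine hasDerivWithinAt_of_entries fun i j => ?_
    by_cases hij : i = j
    · subst hij
      simpa using h i
    · simpa [hij] using hasDerivWithinAt_const t (Ici (0 : ℝ)) (0 : ℂ)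
  refine ⟨fun t => Matrix.diagonal fun j => Complex.exp (Complex.I * φ j t),
    fun t => Matrix.diagonal fun j => Complex.exp (-(Complex.I * φ j t)),
    ⟨fun t ht => ?_, fun t ht => ?_, fun t ht => ?_⟩, fun s t hs ht => ?_⟩
  · refine (hdiag fun j => ((hφ' j t ht).const_mul Complex.I).cexp).congr_deriv ?_
    simp [mul_comm]
  · refine (hdiag fun j => ((hφ' j t ht).const_mul Complex.I).fun_neg.cexp).congr_deriv ?_
    simp
  · simp [← Complex.exp_add]
  · rw [Matrix.diagonal_mul_diagonal]
    congr 1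
    funext j
    rw [← Complex.exp_add, ← sub_eq_add_neg, ← mul_sub]
    congr 2
    rw [hφ]
    simp only
    rw [intervalIntegral.integral_interval_sub_left ((hc j).intervalIntegrable _ _)
      ((hc j).intervalIntegrable _ _)]
    refine intervalIntegral.integral_congr fun τ hτ => ?_
    have : 0 ≤ τ := (le_min hs ht).trans hτ.1
    simp [max_eq_left this]

theorem norm_exp_I_mul_integral {f : ℝ → ℂ} {g : ℝ → ℝ} (hf : ContinuousOn f (Ici 0))
    (hfg : ∀ t, 0 ≤ t → (f t).im = g t) {s t : ℝ} (hs : 0 ≤ s) (ht : 0 ≤ t) :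
    ‖Complex.exp (Complex.I * ∫ τ in s..t, f τ)‖ = Real.exp (-∫ τ in s..t, g τ) := by
  have hsub : uIcc s t ⊆ Ici 0 := fun τ hτ => (le_min hs ht).trans hτ.1
  have h1 : (∫ τ in s..t, f τ).im = ∫ τ in s..t, g τ := by
    have := Complex.imCLM.intervalIntegral_comp_comm
      ((hf.mono hsub).intervalIntegrable (μ := MeasureTheory.volume))
    refine this.symm.trans (intervalIntegral.integral_congr fun τ hτ => hfg τ (hsub hτ))
  rw [Complex.norm_exp, ← h1]
  simp

/-- Since the eigenvalues of A₁ are real, the principal part contributes only phases to the diagonal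
propagator. -/
theorem IsDiagonaliser.diagCoeff_im (hA : IsUniformlyStrictlyHyperbolic A A₁)
    {S : (ℝ → Freq n → Mat d) → Prop} (hM : IsDiagonaliser S A₁ M) {t : ℝ} (ht : 0 ≤ t)
    {ξ : Freq n} (hξ : ξ ≠ 0) (j : Fin d) :
    (diagCoeff A A₁ M t ξ j).im = (F₀ A A₁ M t ξ j j).im := by
  obtain ⟨κ, -, hκ⟩ := hM.exists_eigenvalues hA
  obtain ⟨μ, hμ, -⟩ := hκ t ht ξ hξ
  simp [diagCoeff, hμ, F₀]

theorem of_integral_F₀_eq_diagonal (s t : ℝ) (ξ : Freq n) :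
    (Matrix.of fun i j => ∫ τ in s..t, (F₀ A A₁ M τ ξ i j).im)
      = Matrix.diagonal fun j => ∫ τ in s..t, (F₀ A A₁ M τ ξ j j).im := by
  ext i j
  by_cases hij : i = j
  · subst hij
    simp
  · simp [hij, F₀]

theorem exists_isFundamentalPair_of_symbol {ξ : Freq n} (hξ : ξ ≠ 0)
    (hA : IsUniformlyStrictlyHyperbolic A A₁) :
    ∃ X Y : ℝ → Mat d, X 0 = 1 ∧ Y 0 = 1 ∧
      IsFundamentalPair 0 (fun t => Complex.I • A t ξ) X Y := by
  refine exists_isFundamentalPair (ContinuousOn.const_smul ?_ Complex.I)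
  refine continuousOn_pi.2 fun i => continuousOn_pi.2 fun j => ?_
  exact ((hA.symbol i j).isScalarTimeSymbol.1 ξ hξ).continuousOn

/-- The propagator conjugated by G and the diagonal propagator are integrable perturbations of each
other. The perturbation lemma is applied in one order for each implication, with starting time a =
min(s, t), since the zone is stable under increasing time. -/
theorem generalisedEnergyConservation_iff (hA : IsUniformlyStrictlyHyperbolic A A₁)
    (hM : IsDiagonaliser (IsTimeSymbol 0 0) A₁ M) :
    GeneralisedEnergyConservation A ↔ BoundedDiagonalIntegrals A A₁ M := by
  obtain ⟨c₀, hc₀, K, hK, hcont, htrans⟩ := hM.exists_transform hA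
  set e₁ := ‖(1 : Mat d)‖ with he₁
  have hk : ∀ ξ : Freq n, 0 ≤ K / ‖ξ‖ := fun ξ => div_nonneg hK (norm_nonneg _)
  -- The perturbation bound becomes uniform in ξ: |ξ|(1 + a) ≥ c₀ controls the terms with K/|ξ|, and
  -- 1 + a ≥ 1 the remaining one.
  have hexp : ∀ C : ℝ, 0 ≤ C → ∀ (ξ : Freq n) a, InZone c₀ a ξ →
      C * ((e₁ + 1) * Real.exp (2 * (C * (K / ‖ξ‖) * C + K / ‖ξ‖ + 1) / (1 + a)))
        ≤ C * ((e₁ + 1) * Real.exp (2 * ((C * C + 1) * (K / c₀) + 1))) := by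
    intro C hC ξ a hz
    have h1 : 0 < ‖ξ‖ := norm_pos_iff.2 (hz.ne_zero hc₀)
    have h2 := hz.one_add_pos
    have h3 : K / ‖ξ‖ / (1 + a) ≤ K / c₀ := by
      rw [div_div]
      have := hz.2
      gcongr
      linarith
    have h4 : 1 / (1 + a) ≤ 1 := by
      rw [div_le_one h2]
      linarith [hz.1]
    have h5 : 2 * (C * (K / ‖ξ‖) * C + K / ‖ξ‖ + 1) / (1 + a)
        = 2 * ((C * C + 1) * (K / ‖ξ‖ / (1 + a)) + 1 / (1 + a)) := by
      field_simp
    rw [h5]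
    gcongr
  constructor
  · rintro ⟨E, hE, c, hc, C, hC⟩
    set c' := max c c₀ with hc'
    set C' := |K * C * K| with hC'
    refine ⟨c', lt_max_of_lt_left hc,
      C' * ((e₁ + 1) * Real.exp (2 * ((C' * C' + 1) * (K / c₀) + 1))), fun s t ξ ht hs => ?_⟩
    have hξ : ξ ≠ 0 := ht.ne_zero (lt_max_of_lt_left hc)
    obtain ⟨X, Y, -, -, hXY⟩ := exists_isFundamentalPair_of_symbol hξ hA
    obtain ⟨XD, YD, hD, hDexp⟩ := exists_isFundamentalPair_diagonal (hcont ξ hξ)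
    set a := min s t with ha
    have ha0 : 0 ≤ a := le_min hs.1 ht.1
    have hza : InZone c' a ξ := by
      rcases min_choice s t with h | h <;> rw [ha, h] <;> assumption
    have hza₀ : InZone c₀ a ξ := hza.of_le (le_max_right _ _)
    have hzc : ∀ τ, a ≤ τ → InZone c τ ξ := fun τ hτ =>
      (hza.of_time_le hτ).of_le (le_max_left _ _)
    obtain ⟨G, H, hGH, hQ⟩ := htrans ξ a hza₀
    obtain ⟨Q, hQpair, hQb⟩ := hQ X Y (hXY.mono ha0)
    have hb : ∀ s t, a ≤ s → a ≤ t → ‖H t * X t * (Y s * G s)‖ ≤ C' := by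
      intro s t hs ht
      have h1 : ‖X t * Y s‖ ≤ C := by
        rw [← hE.eq_mul hξ hXY (ha0.trans hs) (ha0.trans ht)]
        exact hC s t ξ (hzc t ht) (hzc s hs)
      calc ‖H t * X t * (Y s * G s)‖ = ‖H t * (X t * Y s) * G s‖ := by simp only [mul_assoc]
        _ ≤ ‖H t‖ * ‖X t * Y s‖ * ‖G s‖ :=
          (norm_mul_le _ _).trans (mul_le_mul_of_nonneg_right (norm_mul_le _ _) (norm_nonneg _))
        _ ≤ K * C * K := mul_le_mul (mul_le_mul (hGH t ht).2.1 h1 (norm_nonneg _) hK)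
          (hGH s hs).1 (norm_nonneg _) (mul_nonneg hK ((norm_nonneg _).trans h1))
        _ ≤ C' := le_abs_self _
    -- The modulus of a diagonal entry is exp(−∫ Im F⁽⁰⁾), and x + 1 ≤ exp x turns its bound into
    -- one for the exponent. Exchanging s and t gives the other sign.
    have hbound : ∀ s t, a ≤ s → a ≤ t → ∀ j,
        -∫ τ in s..t, (F₀ A A₁ M τ ξ j j).im
          ≤ C' * ((e₁ + 1) * Real.exp (2 * ((C' * C' + 1) * (K / c₀) + 1))) := by
      intro s t hs ht j
      have h1 := hQpair.norm_le_of_perturbation (hD.mono ha0) ha0 (hk ξ) hb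
        (fun t ht => by rw [norm_sub_rev]; exact hQb t ht) hs ht
      have h2 := norm_exp_I_mul_integral (hcont ξ hξ j)
        (fun τ hτ => hM.diagCoeff_im hA hτ hξ j) (ha0.trans hs) (ha0.trans ht)
      have h3 := norm_entry_le (XD t * YD s) j j
      rw [hDexp s t (ha0.trans hs) (ha0.trans ht), Matrix.diagonal_apply_eq, h2] at h3
      rw [hDexp s t (ha0.trans hs) (ha0.trans ht)] at h1
      have h4 := Real.add_one_le_exp (-∫ τ in s..t, (F₀ A A₁ M τ ξ j j).im)
      have h5 := hexp C' (abs_nonneg _) ξ a hza₀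
      linarith
    rw [of_integral_F₀_eq_diagonal, Matrix.linfty_opNorm_diagonal]
    refine (pi_norm_le_iff_of_nonneg (by positivity)).2 fun j => ?_
    rw [Real.norm_eq_abs, abs_le']
    refine ⟨?_, hbound s t (min_le_left _ _) (min_le_right _ _) j⟩
    have := hbound t s (min_le_right _ _) (min_le_left _ _) j
    rwa [intervalIntegral.integral_symm, neg_neg] at this
  · rintro ⟨c, hc, C, hC⟩
    have hex : ∀ ξ : Freq n, ∃ X Y : ℝ → Mat d, ξ ≠ 0 →
        IsFundamentalPair 0 (fun t => Complex.I • A t ξ) X Y := fun ξ => by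
      by_cases hξ : ξ = 0
      · exact ⟨1, 1, fun h => absurd hξ h⟩
      · obtain ⟨X, Y, -, -, h⟩ := exists_isFundamentalPair_of_symbol hξ hA
        exact ⟨X, Y, fun _ => h⟩
    choose X Y hXY using hex
    set C' := Real.exp C with hC'
    set c' := max c c₀ with hc'
    refine ⟨fun t s ξ => X ξ t * Y ξ s, fun ξ hξ s hs =>
      ⟨(hXY ξ hξ).left_mul_right hs, fun t ht i j => ?_⟩, c', lt_max_of_lt_left hc,
      K * (C' * ((e₁ + 1) * Real.exp (2 * ((C' * C' + 1) * (K / c₀) + 1)))) * K,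
      fun s t ξ ht hs => ?_⟩
    · have h1 := hasDerivWithinAt_entry (((hXY ξ hξ).deriv_left t ht).mul_const (Y ξ s)) i j
      exact h1.congr_deriv (by simp [mul_assoc])
    have hξ : ξ ≠ 0 := ht.ne_zero (lt_max_of_lt_left hc)
    obtain ⟨XD, YD, hD, hDexp⟩ := exists_isFundamentalPair_diagonal (hcont ξ hξ)
    set a := min s t with ha
    have ha0 : 0 ≤ a := le_min hs.1 ht.1
    have has : a ≤ s := min_le_left _ _
    have hat : a ≤ t := min_le_right _ _
    have hza : InZone c' a ξ := by
      rcases min_choice s t with h | h <;> rw [ha, h] <;> assumption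
    have hza₀ : InZone c₀ a ξ := hza.of_le (le_max_right _ _)
    have hzc : ∀ τ, a ≤ τ → InZone c τ ξ := fun τ hτ =>
      (hza.of_time_le hτ).of_le (le_max_left _ _)
    obtain ⟨G, H, hGH, hQ⟩ := htrans ξ a hza₀
    obtain ⟨Q, hQpair, hQb⟩ := hQ _ _ ((hXY ξ hξ).mono ha0)
    have hb : ∀ s t, a ≤ s → a ≤ t → ‖XD t * YD s‖ ≤ C' := by
      intro s t hs ht
      rw [hDexp s t (ha0.trans hs) (ha0.trans ht), Matrix.linfty_opNorm_diagonal]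
      refine (pi_norm_le_iff_of_nonneg (Real.exp_pos C).le).2 fun j => ?_
      rw [norm_exp_I_mul_integral (hcont ξ hξ j)
        (fun τ hτ => hM.diagCoeff_im hA hτ hξ j) (ha0.trans hs) (ha0.trans ht)]
      have h1 := hC s t ξ (hzc t ht) (hzc s hs)
      have h2 := norm_entry_le
        (Matrix.of fun i j => ∫ τ in s..t, (F₀ A A₁ M τ ξ i j).im) j j
      rw [Matrix.of_apply, Real.norm_eq_abs] at h2
      exact Real.exp_le_exp.2 ((neg_le_abs _).trans (h2.trans h1))
    have h1 := (hD.mono ha0).norm_le_of_perturbation hQpair ha0 (hk ξ) hb hQb has hat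
    have h2 := h1.trans (hexp C' (Real.exp_pos C).le ξ a hza₀)
    have e : X ξ t * Y ξ s = G t * (H t * X ξ t * (Y ξ s * G s)) * H s := by
      have g1 := (hGH t hat).2.2
      have g2 := (hGH s has).2.2
      calc X ξ t * Y ξ s = G t * H t * X ξ t * Y ξ s * (G s * H s) := by
            rw [g1, g2, one_mul, mul_one]
        _ = _ := by simp only [mul_assoc]
    beta_reduce
    rw [e]
    refine (norm_mul_le _ _).trans (mul_le_mul ((norm_mul_le _ _).trans
      (mul_le_mul (hGH t hat).1 h2 (norm_nonneg _) hK)) (hGH s has).2.1 (norm_nonneg _)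
      (by positivity))

end Equivalence

end HypSys

namespace HypSys

open Set Polynomial Matrix

/-! ### Spectral projections of a matrix with simple spectrum. -/

section SpectralProjections

variable {d : ℕ}

/-- The spectral projection `∏_{k ≠ j} (B - l k) / (l j - l k)`. -/
noncomputable def specProj (B : Mat d) (l : Fin d → ℂ) (j : Fin d) : Mat d :=
  ((Finset.univ.erase j).toList.map fun k => (l j - l k)⁻¹ • (B - l k • (1 : Mat d))).prod

/-- Through this identification, Lagrange interpolation supplies the algebra of the projections:
values at the nodes give products, and the basis polynomials summing to 1 give completeness. -/
theorem specProj_eq_aeval (B : Mat d) (l : Fin d → ℂ) (j : Fin d) :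
    specProj B l j = aeval B (Lagrange.basis Finset.univ l j) := by
  rw [Lagrange.basis, ← Finset.prod_map_toList, map_list_prod, List.map_map, specProj]
  congr 2
  funext k
  rw [Function.comp_apply, Lagrange.basisDivisor, map_mul, aeval_C, map_sub, aeval_X, aeval_C,
    ← Algebra.smul_def, Algebra.algebraMap_eq_smul_one]

variable {B : Mat d} {l : Fin d → ℂ}

/-- X − l_j times the j-th Lagrange polynomial is a constant multiple of the characteristic
polynomial, which annihilates B by Cayley–Hamilton. -/
theorem mul_specProj (hch : B.charpoly = ∏ j, (X - C (l j))) (j : Fin d) :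
    B * specProj B l j = l j • specProj B l j := by
  have h1 : (X - C (l j)) * Lagrange.basis Finset.univ l j
      = (∏ k ∈ Finset.univ.erase j, C ((l j - l k)⁻¹)) * B.charpoly := by
    rw [hch, ← Finset.mul_prod_erase Finset.univ _ (Finset.mem_univ j), Lagrange.basis]
    simp only [Lagrange.basisDivisor, Finset.prod_mul_distrib]
    ring
  have h2 := congrArg (aeval B) h1
  rw [map_mul, map_mul, Matrix.aeval_self_charpoly, mul_zero, ← specProj_eq_aeval] at h2
  simp only [map_sub, aeval_X, aeval_C, sub_mul, ← Algebra.smul_def] at h2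
  exact sub_eq_zero.1 h2

theorem specProj_mul (hch : B.charpoly = ∏ j, (X - C (l j))) (j : Fin d) :
    specProj B l j * B = l j • specProj B l j := by
  rw [← mul_specProj hch, specProj_eq_aeval]
  have := Polynomial.aeval_mul (x := B) (p := Lagrange.basis Finset.univ l j) (q := X)
  have h2 := Polynomial.aeval_mul (x := B) (p := X) (q := Lagrange.basis Finset.univ l j)
  rw [aeval_X] at this h2
  rw [← this, ← h2, mul_comm]

/-- Modulo X − l_j, which annihilates the projection, p reduces to its value at l_j. -/
theorem aeval_mul_specProj (hch : B.charpoly = ∏ j, (X - C (l j))) (p : ℂ[X]) (j : Fin d) :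
    aeval B p * specProj B l j = p.eval (l j) • specProj B l j := by
  obtain ⟨q, hq⟩ := X_sub_C_dvd_sub_C_eval (p := p) (a := l j)
  have h1 : p = q * (X - C (l j)) + C (p.eval (l j)) := by
    rw [mul_comm, ← hq, sub_add_cancel]
  conv_lhs => rw [h1]
  rw [map_add, map_mul, add_mul, mul_assoc]
  simp only [map_sub, aeval_X, aeval_C, sub_mul, ← Algebra.smul_def]
  rw [mul_specProj hch, sub_self, mul_zero, zero_add]

theorem specProj_mul_self (hch : B.charpoly = ∏ j, (X - C (l j)))
    (hl : Function.Injective l) (j : Fin d) :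
    specProj B l j * specProj B l j = specProj B l j := by
  conv_lhs => lhs; rw [specProj_eq_aeval]
  rw [aeval_mul_specProj hch, Lagrange.eval_basis_self hl.injOn (Finset.mem_univ j), one_smul]

theorem specProj_mul_of_ne (hch : B.charpoly = ∏ j, (X - C (l j))) {i j : Fin d} (hij : i ≠ j) :
    specProj B l i * specProj B l j = 0 := by
  conv_lhs => lhs; rw [specProj_eq_aeval]
  rw [aeval_mul_specProj hch, Lagrange.eval_basis_of_ne hij (Finset.mem_univ j), zero_smul]

theorem exists_eigenvector (hch : B.charpoly = ∏ j, (X - C (l j))) (j : Fin d) :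
    ∃ v : Fin d → ℂ, v ≠ 0 ∧ B *ᵥ v = l j • v := by
  have h1 : (Matrix.scalar (Fin d) (l j) - B).det = 0 := by
    rw [← Matrix.eval_charpoly, hch, eval_prod]
    exact Finset.prod_eq_zero (Finset.mem_univ j) (by simp)
  obtain ⟨v, hv, h2⟩ := Matrix.exists_mulVec_eq_zero_iff.2 h1
  refine ⟨v, hv, ?_⟩
  rw [Matrix.sub_mulVec, sub_eq_zero] at h2
  rw [← h2]
  simp [← Matrix.smul_one_eq_diagonal, Matrix.smul_mulVec]

theorem norm_eigenvalue_le (hch : B.charpoly = ∏ j, (X - C (l j))) (j : Fin d) :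
    ‖l j‖ ≤ ‖B‖ := by
  obtain ⟨v, hv, h⟩ := exists_eigenvector hch j
  have h1 := Matrix.linfty_opNorm_mulVec B v
  rw [h, norm_smul] at h1
  exact le_of_mul_le_mul_right h1 (norm_pos_iff.2 hv)

theorem specProj_mulVec_eigenvector (hl : Function.Injective l) {j : Fin d} {v : Fin d → ℂ}
    (hv : B *ᵥ v = l j • v) : specProj B l j *ᵥ v = v := by
  have key : ∀ L : List (Fin d), j ∉ L →
      (L.map fun k => (l j - l k)⁻¹ • (B - l k • (1 : Mat d))).prod *ᵥ v = v := by
    intro L hL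
    induction L with
    | nil => simp
    | cons k L ih =>
      simp only [List.mem_cons, not_or] at hL
      have hne : l j - l k ≠ 0 := sub_ne_zero.2 (hl.ne hL.1)
      rw [List.map_cons, List.prod_cons, ← Matrix.mulVec_mulVec, ih hL.2, Matrix.smul_mulVec,
        Matrix.sub_mulVec, hv, Matrix.smul_mulVec, Matrix.one_mulVec, ← sub_smul, smul_smul,
        inv_mul_cancel₀ hne, one_smul]
  exact key _ (by simp)

theorem specProj_ne_zero (hch : B.charpoly = ∏ j, (X - C (l j)))
    (hl : Function.Injective l) (j : Fin d) : specProj B l j ≠ 0 := by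
  obtain ⟨v, hv, h⟩ := exists_eigenvector hch j
  intro h0
  have := specProj_mulVec_eigenvector hl h
  rw [h0, Matrix.zero_mulVec] at this
  exact hv this.symm

/-- The trace of an idempotent is its rank. -/
theorem exists_nat_eq_trace_of_mul_self_eq {P : Mat d} (hP : P * P = P) (h0 : P ≠ 0) :
    ∃ m : ℕ, 1 ≤ m ∧ P.trace = m := by
  have hid : IsIdempotentElem (Matrix.toLin' P) := by
    rw [IsIdempotentElem, Module.End.mul_eq_comp, ← Matrix.toLin'_mul, hP]
  have h1 := (LinearMap.IsIdempotentElem.isProj_range _ hid).trace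
  rw [Matrix.trace_toLin'_eq] at h1
  refine ⟨_, Nat.one_le_iff_ne_zero.2 fun h2 => h0 ?_, h1⟩
  rw [h2, Nat.cast_zero, ← Matrix.trace_toLin'_eq] at h1
  have := (LinearMap.IsIdempotentElem.trace_eq_zero_iff hid).1 h1
  simpa using this

/-- The d traces are positive integers with sum tr 1 = d, so each of them is 1. -/
theorem trace_specProj (hch : B.charpoly = ∏ j, (X - C (l j)))
    (hl : Function.Injective l) (j : Fin d) : (specProj B l j).trace = 1 := by
  choose m hm htr using fun j =>
    exists_nat_eq_trace_of_mul_self_eq (specProj_mul_self hch hl j) (specProj_ne_zero hch hl j)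
  have hsum : ∑ j, specProj B l j = 1 := by
    simp only [specProj_eq_aeval]
    rw [← map_sum, Lagrange.sum_basis hl.injOn ⟨j, Finset.mem_univ j⟩, map_one]
  have h1 : ∑ j, m j = ∑ _j : Fin d, 1 := by
    have := congrArg Matrix.trace hsum
    rw [Matrix.trace_sum, Matrix.trace_one] at this
    simp only [htr] at this
    simpa using (by exact_mod_cast this : ∑ j, m j = Fintype.card (Fin d))
  have h2 := (Finset.sum_eq_sum_iff_of_le fun j _ => hm j).1 h1.symm j (Finset.mem_univ j)
  rw [htr, ← h2, Nat.cast_one]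

end SpectralProjections

/-! ### Continuity and differentiability of ordered eigenvalues. -/

section Eigenvalues

variable {d : ℕ} {B : ℝ → Mat d} {lam : ℝ → Fin d → ℝ} {κ : ℝ}

/-- Ordered uniformly separated eigenvalues depend continuously on the matrix. -/
theorem continuousOn_eigenvalue (hB : ContinuousOn B (Ici 0))
    (hch : ∀ t, 0 ≤ t → (B t).charpoly = ∏ j, (X - C ((lam t j : ℝ) : ℂ)))
    (hmono : ∀ t, 0 ≤ t → StrictMono (lam t)) (hκ : 0 < κ)
    (hsep : ∀ t, 0 ≤ t → ∀ i j, i ≠ j → κ ≤ |lam t i - lam t j|) (j : Fin d) :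
    ContinuousOn (fun t => lam t j) (Ici 0) := by
  intro t ht
  rw [Metric.continuousWithinAt_iff']
  intro ε hε
  -- With δ ≤ κ/2, matching each eigenvalue at t to one at s within δ preserves the order. A
  -- strictly increasing self-map of `Fin d` is the identity, so the labels agree.
  set δ := min ε (κ / 2) with hδ
  have hδ0 : 0 < δ := lt_min hε (half_pos hκ)
  have hdet : ∀ i, Filter.Tendsto
      (fun s => (Matrix.scalar (Fin d) ((lam t i : ℝ) : ℂ) - B s).det)
      (nhdsWithin t (Ici 0)) (nhds 0) := fun i => by
    have h0 : (Matrix.scalar (Fin d) ((lam t i : ℝ) : ℂ) - B t).det = 0 := by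
      rw [← Matrix.eval_charpoly, hch t ht, eval_prod]
      exact Finset.prod_eq_zero (Finset.mem_univ i) (by simp)
    rw [← h0]
    have hc : Continuous fun Z : Mat d =>
        (Matrix.scalar (Fin d) ((lam t i : ℝ) : ℂ) - Z).det :=
      (continuous_const.sub continuous_id).matrix_det
    exact (hc.tendsto _).comp (hB t ht)
  have hev : ∀ᶠ s in nhdsWithin t (Ici 0), ∀ i,
      ‖(Matrix.scalar (Fin d) ((lam t i : ℝ) : ℂ) - B s).det‖ < δ ^ d :=
    Filter.eventually_all.2 fun i => by
      have := (hdet i).norm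
      rw [norm_zero] at this
      exact this.eventually_lt_const (pow_pos hδ0 d)
  filter_upwards [hev, self_mem_nhdsWithin] with s hs hs0
  -- If every eigenvalue at s were at least δ away, the product of the differences would have
  -- modulus at least δ^d, against the smallness of the determinant.
  have hclose : ∀ i, ∃ k, |lam t i - lam s k| < δ := fun i => by
    by_contra! hcon
    have h1 := hs i
    rw [← Matrix.eval_charpoly, hch s hs0, eval_prod, norm_prod] at h1
    have h2 : ∏ _k : Fin d, δ ≤ ∏ k, ‖eval ((lam t i : ℝ) : ℂ) (X - C ((lam s k : ℝ) : ℂ))‖ := by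
      refine Finset.prod_le_prod (fun _ _ => hδ0.le) fun k _ => ?_
      rw [eval_sub, eval_X, eval_C, ← Complex.ofReal_sub, Complex.norm_real]
      exact hcon k
    simp only [Finset.prod_const, Finset.card_univ, Fintype.card_fin] at h2
    linarith
  choose σ hσ using hclose
  have hσm : StrictMono σ := fun a b hab => by
    have h1 := hσ a
    have h2 := hσ b
    have h3 := hsep t ht a b hab.ne
    have h4 := hmono t ht hab
    rw [abs_of_neg (by linarith)] at h3
    rw [abs_lt] at h1 h2
    have h5 : δ ≤ κ / 2 := min_le_right _ _
    refine (hmono s hs0).lt_iff_lt.1 ?_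
    linarith
  have h1 := hσ j
  rw [hσm.eq_id, id] at h1
  rw [Real.dist_eq, abs_sub_comm]
  exact h1.trans_le (min_le_left _ _)

theorem continuousOn_specProj {l : ℝ → Fin d → ℂ} (hB : ContinuousOn B (Ici 0))
    (hl : ∀ j, ContinuousOn (fun t => l t j) (Ici 0))
    (hinj : ∀ t, 0 ≤ t → Function.Injective (l t)) (j : Fin d) :
    ContinuousOn (fun t => specProj (B t) (l t) j) (Ici 0) := by
  have key : ∀ L : List (Fin d), j ∉ L → ContinuousOn (fun t =>
      (L.map fun k => (l t j - l t k)⁻¹ • (B t - l t k • (1 : Mat d))).prod) (Ici 0) := by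
    intro L hL
    induction L with
    | nil => simpa using continuousOn_const
    | cons k L ih =>
      simp only [List.mem_cons, not_or] at hL
      simp only [List.map_cons, List.prod_cons]
      refine ContinuousOn.fun_mul (ContinuousOn.fun_smul ?_
        (hB.fun_sub ((hl k).fun_smul continuousOn_const))) (ih hL.2)
      exact ((hl j).sub (hl k)).inv₀ fun t ht => sub_ne_zero.2 ((hinj t ht).ne hL.1)
  exact key _ (by simp)

/-- The derivative of a simple eigenvalue. -/
theorem hasDerivWithinAt_eigenvalue {B' : Mat d} {t : ℝ} (ht : 0 ≤ t)
    (hB : ContinuousOn B (Ici 0)) (hd : HasDerivWithinAt B B' (Ici 0) t)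
    (hch : ∀ t, 0 ≤ t → (B t).charpoly = ∏ j, (X - C ((lam t j : ℝ) : ℂ)))
    (hmono : ∀ t, 0 ≤ t → StrictMono (lam t)) (hκ : 0 < κ)
    (hsep : ∀ t, 0 ≤ t → ∀ i j, i ≠ j → κ ≤ |lam t i - lam t j|) (j : Fin d) :
    HasDerivWithinAt (fun t => ((lam t j : ℝ) : ℂ))
      (specProj (B t) (fun k => (lam t k : ℂ)) j * B').trace (Ici 0) t := by
  have hinj : ∀ t, 0 ≤ t → Function.Injective fun k => (lam t k : ℂ) := fun t ht =>
    Complex.ofReal_injective.comp (hmono t ht).injective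
  set P : ℝ → Mat d := fun t => specProj (B t) (fun k => (lam t k : ℂ)) j with hP
  have hPc : ContinuousOn P (Ici 0) := continuousOn_specProj hB
    (fun j => Complex.continuous_ofReal.comp_continuousOn
      (continuousOn_eigenvalue hB hch hmono hκ hsep j)) hinj j
  have hPt : Filter.Tendsto P (nhdsWithin t (Ici 0 \ {t})) (nhds (P t)) :=
    (hPc t ht).mono_left (nhdsWithin_mono _ sdiff_subset)
  have htr : Continuous fun Z : Mat d => Z.trace := continuous_id.matrix_trace
  have hPP : P t * P t = P t := specProj_mul_self (hch t ht) (hinj t ht) j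
  have htr1 : (P t).trace = 1 := trace_specProj (hch t ht) (hinj t ht) j
  replace hd := hasDerivWithinAt_iff_tendsto_slope.1 hd
  rw [hasDerivWithinAt_iff_tendsto_slope]
  -- Since P(t)(B(s) − B(t))P(s) = (λ(s) − λ(t))P(t)P(s), taking traces writes the difference
  -- quotient of λ through that of B. Only continuity of P is needed, and the denominator tends to
  -- tr P(t) = 1.
  have h1 : Filter.Tendsto (fun s => (P t * slope B t s * P s).trace / (P t * P s).trace)
      (nhdsWithin t (Ici 0 \ {t})) (nhds ((P t * B').trace)) := by
    have hn := (htr.tendsto _).comp ((hd.const_mul (P t)).mul hPt)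
    have hdn := (htr.tendsto _).comp (hPt.const_mul (P t))
    have := hn.div hdn (by rw [hPP, htr1]; exact one_ne_zero)
    rw [hPP, htr1, div_one, Matrix.trace_mul_comm, ← mul_assoc, hPP] at this
    exact this
  refine h1.congr' ?_
  have hne : ∀ᶠ s in nhdsWithin t (Ici 0 \ {t}), (P t * P s).trace ≠ 0 := by
    have hdn := (htr.tendsto _).comp (hPt.const_mul (P t))
    refine hdn.eventually_ne ?_
    rw [hPP, htr1]
    exact one_ne_zero
  filter_upwards [hne, self_mem_nhdsWithin] with s hs hs0
  rw [div_eq_iff hs, slope, slope, vsub_eq_sub, vsub_eq_sub]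
  have e1 : P t * B t = (lam t j : ℂ) • P t := specProj_mul (hch t ht) j
  have e2 : B s * P s = (lam s j : ℂ) • P s := mul_specProj (hch s hs0.1) j
  rw [mul_smul_comm, smul_mul_assoc, Matrix.trace_smul, smul_mul_assoc]
  congr 1
  rw [mul_sub, sub_mul, e1, mul_assoc, e2, mul_smul_comm, smul_mul_assoc, ← sub_smul,
    Matrix.trace_smul, smul_eq_mul]

end Eigenvalues

end HypSys

namespace HypSys

open Set Polynomial Matrix

/-! ### Kato transport and unit sections of a family of projections. -/

section UnitSection

variable {d : ℕ}

/-- Multiplying the differentiated identity P² = P by P on both sides produces PP'P twice on the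
left and once on the right. -/
theorem mul_deriv_mul_eq_zero {R : Type*} [Ring R] {P P' : R} (hP : P * P = P)
    (hP' : P' * P + P * P' = P') : P * P' * P = 0 := by
  have h : P * (P' * P + P * P') * P = P * P' * P := by rw [hP']
  have e : P * (P' * P + P * P') * P = P * P' * (P * P) + (P * P) * P' * P := by noncomm_ring
  rw [e, hP] at h
  simpa using h

theorem hasDerivWithinAt_mulVec {X : ℝ → Mat d} {X' : Mat d} {s : Set ℝ} {t : ℝ}
    (h : HasDerivWithinAt X X' s t) (v : Fin d → ℂ) (i : Fin d) :
    HasDerivWithinAt (fun τ => (X τ *ᵥ v) i) ((X' *ᵥ v) i) s t := by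
  simp only [Matrix.mulVec, dotProduct]
  exact HasDerivWithinAt.fun_sum fun k _ => (hasDerivWithinAt_entry h i k).mul_const (v k)

/-- A nonvanishing section of the range of a smooth family of projections (Kato's transport). -/
theorem exists_section_of_projection {P P' : ℝ → Mat d}
    (hd : ∀ t, 0 ≤ t → HasDerivWithinAt P (P' t) (Ici 0) t) (hc : ContinuousOn P' (Ici 0))
    (hP : ∀ t, 0 ≤ t → P t * P t = P t) (h0 : P 0 ≠ 0) :
    ∃ u : ℝ → Fin d → ℂ, ∀ t, 0 ≤ t → u t ≠ 0 ∧ P t *ᵥ u t = u t ∧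
      ∀ i, HasDerivWithinAt (fun τ => u τ i) ((P' t *ᵥ u t) i) (Ici 0) t := by
  have hPc : ContinuousOn P (Ici 0) := fun t ht => (hd t ht).continuousWithinAt
  have hP' : ∀ t, 0 ≤ t → P' t * P t + P t * P' t = P' t := fun t ht =>
    (uniqueDiffOn_Ici 0 t ht).eq_deriv _ ((hd t ht).mul (hd t ht))
      ((hd t ht).congr (fun τ hτ => hP τ hτ) (hP t ht))
  -- Kato's generator K = [P', P] satisfies [K, P] = P'. Hence YPX is constant, and X carries the
  -- range of P(0) to the range of P(t).
  obtain ⟨X, Y, hX0, hY0, hXY⟩ := exists_isFundamentalPair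
    (P := fun t => P' t * P t - P t * P' t) ((hc.mul hPc).sub (hPc.mul hc))
  have htransport : ∀ t, 0 ≤ t → P t * X t = X t * P 0 := by
    intro t ht
    have h1 := eq_of_hasDerivWithinAt_zero (f := fun t => Y t * P t * X t) (a := 0)
      (fun t ht => (((hXY.deriv_right t ht).mul (hd t ht)).mul
        (hXY.deriv_left t ht)).congr_deriv (by
          have e1 := mul_deriv_mul_eq_zero (hP t ht) (hP' t ht)
          have e2 := hP' t ht
          have e3 := hP t ht
          calc _ = Y t * (-(P' t * (P t * P t)) + P t * P' t * P t + P' t + P t * P' t * P t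
                  - (P t * P t) * P' t) * X t := by
                simp only [Pi.mul_apply]
                noncomm_ring
            _ = Y t * (P' t - (P' t * P t + P t * P' t)) * X t := by
                rw [e1, e3]; noncomm_ring
            _ = 0 := by rw [e2, sub_self, mul_zero, zero_mul])) le_rfl ht
    simp only [hX0, hY0, one_mul, mul_one] at h1
    rw [← h1, mul_assoc, ← mul_assoc (X t), hXY.left_mul_right ht, one_mul]
  obtain ⟨v, hv⟩ : ∃ v, P 0 *ᵥ v ≠ 0 := by
    by_contra! hcon
    exact h0 (Matrix.ext_of_mulVec_single fun i => by rw [hcon, Matrix.zero_mulVec])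
  refine ⟨fun t => X t *ᵥ (P 0 *ᵥ v), fun t ht => ⟨fun hz => hv ?_, ?_, fun i => ?_⟩⟩
  · have h1 := congrArg (fun w => Y t *ᵥ w) hz
    simpa [Matrix.mulVec_mulVec, ← mul_assoc, hXY.right_mul_left t ht] using h1
  · rw [Matrix.mulVec_mulVec, htransport t ht, ← Matrix.mulVec_mulVec, Matrix.mulVec_mulVec _ (P 0),
      hP 0 le_rfl]
  -- On the range of P the term PP' drops out because PP'P = 0, so u' = [P', P]u simplifies to P'u.
  · refine (hasDerivWithinAt_mulVec (hXY.deriv_left t ht) (P 0 *ᵥ v) i).congr_deriv ?_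
    have e1 := mul_deriv_mul_eq_zero (hP t ht) (hP' t ht)
    have e2 : (P' t * P t - P t * P' t) * P t = P' t * P t := by
      rw [sub_mul, mul_assoc, hP t ht, e1, sub_zero]
    have e3 : (P' t * P t - P t * P' t) * X t * P 0 = P' t * X t * P 0 := by
      calc (P' t * P t - P t * P' t) * X t * P 0
          = (P' t * P t - P t * P' t) * P t * X t := by
            rw [mul_assoc, ← htransport t ht, ← mul_assoc]
        _ = P' t * X t * P 0 := by rw [e2, mul_assoc, htransport t ht, mul_assoc]
    simp only [Matrix.mulVec_mulVec, ← mul_assoc, e3]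

/-- A unit section of the range of a smooth family of projections. -/
theorem exists_unit_section_of_projection {P P' : ℝ → Mat d}
    (hd : ∀ t, 0 ≤ t → HasDerivWithinAt P (P' t) (Ici 0) t) (hc : ContinuousOn P' (Ici 0))
    (hP : ∀ t, 0 ≤ t → P t * P t = P t) (h0 : P 0 ≠ 0) :
    ∃ w : ℝ → Fin d → ℂ, ∀ t, 0 ≤ t → ∑ k, starRingEnd ℂ (w t k) * w t k = 1 ∧
      P t *ᵥ w t = w t ∧
      ∀ i, HasDerivWithinAt (fun τ => w τ i) ((P' t *ᵥ w t) i - w t i * (2⁻¹ *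
        (∑ k, starRingEnd ℂ (w t k) * (P' t *ᵥ w t) k
          + starRingEnd ℂ (∑ k, starRingEnd ℂ (w t k) * (P' t *ᵥ w t) k)))) (Ici 0) t := by
  obtain ⟨u, hu⟩ := exists_section_of_projection hd hc hP h0
  set η : ℝ → ℝ := fun t => ∑ k, Complex.normSq (u t k) with hη
  have hηc : ∀ t, ∑ k, starRingEnd ℂ (u t k) * u t k = (η t : ℂ) := fun t => by
    simp only [hη, Complex.ofReal_sum, Complex.normSq_eq_conj_mul_self]
  have hηpos : ∀ t, 0 ≤ t → 0 < η t := fun t ht => by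
    obtain ⟨k, hk⟩ := Function.ne_iff.1 (hu t ht).1
    exact Finset.sum_pos' (fun k _ => Complex.normSq_nonneg _)
      ⟨k, Finset.mem_univ k, Complex.normSq_pos.2 hk⟩
  set Q : ℝ → ℂ := fun t => ∑ k, starRingEnd ℂ (u t k) * (P' t *ᵥ u t) k with hQ
  have hη' : ∀ t, 0 ≤ t → HasDerivWithinAt η (2 * (Q t).re) (Ici 0) t := by
    intro t ht
    have h1 : HasDerivWithinAt (fun τ => ∑ k, starRingEnd ℂ (u τ k) * u τ k)
        (∑ k, (starRingEnd ℂ ((P' t *ᵥ u t) k) * u t k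
          + starRingEnd ℂ (u t k) * (P' t *ᵥ u t) k)) (Ici 0) t :=
      HasDerivWithinAt.fun_sum fun k _ =>
        (Complex.conjCLE.toContinuousLinearMap.hasFDerivAt.comp_hasDerivWithinAt t
          ((hu t ht).2.2 k)).mul ((hu t ht).2.2 k)
    have h2 := Complex.reCLM.hasFDerivAt.comp_hasDerivWithinAt t h1
    have h3 : HasDerivWithinAt η (Complex.reCLM (∑ k, (starRingEnd ℂ ((P' t *ᵥ u t) k) * u t k
          + starRingEnd ℂ (u t k) * (P' t *ᵥ u t) k))) (Ici 0) t := by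
      refine h2.congr (fun τ _ => ?_) ?_ <;> simp [hηc]
    refine h3.congr_deriv ?_
    rw [Finset.sum_add_distrib, map_add, two_mul]
    simp only [Complex.reCLM_apply, hQ]
    congr 1
    rw [Complex.re_sum, Complex.re_sum]
    refine Finset.sum_congr rfl fun k _ => ?_
    simp only [Complex.mul_re, Complex.conj_re, Complex.conj_im]
    ring
  set σ : ℝ → ℝ := fun t => (√(η t))⁻¹ with hσ
  have hσ2 : ∀ t, 0 ≤ t → σ t * σ t * η t = 1 := fun t ht => by
    have h1 := hηpos t ht
    rw [hσ]
    simp only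
    rw [← mul_inv, Real.mul_self_sqrt h1.le, inv_mul_cancel₀ h1.ne']
  have hσ' : ∀ t, 0 ≤ t → HasDerivWithinAt (fun τ => (σ τ : ℂ))
      ((-(σ t * (σ t * σ t * (Q t).re)) : ℝ) : ℂ) (Ici 0) t := by
    intro t ht
    have h1 := hηpos t ht
    have h2 := ((hη' t ht).sqrt h1.ne').fun_inv (Real.sqrt_ne_zero'.2 h1)
    refine (HasDerivWithinAt.ofReal_comp h2).congr_deriv ?_
    congr 1
    simp only [hσ]
    have h3 : √(η t) ≠ 0 := Real.sqrt_ne_zero'.2 h1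
    field_simp
  have hsmul : ∀ t, P' t *ᵥ ((σ t : ℂ) • u t) = (σ t : ℂ) • (P' t *ᵥ u t) := fun t =>
    Matrix.mulVec_smul _ _ _
  refine ⟨fun t => (σ t : ℂ) • u t, fun t ht => ⟨?_, ?_, fun i => ?_⟩⟩
  · have h1 : ∑ k, starRingEnd ℂ (((σ t : ℂ) • u t) k) * ((σ t : ℂ) • u t) k
        = (σ t * σ t : ℂ) * ∑ k, starRingEnd ℂ (u t k) * u t k := by
      rw [Finset.mul_sum]
      refine Finset.sum_congr rfl fun k _ => ?_
      simp only [Pi.smul_apply, smul_eq_mul, map_mul, Complex.conj_ofReal]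
      ring
    rw [h1, hηc]
    exact_mod_cast hσ2 t ht
  · rw [Matrix.mulVec_smul, (hu t ht).2.1]
  · refine ((hσ' t ht).mul ((hu t ht).2.2 i)).congr_deriv ?_
    -- Scaling by the real factor σ multiplies the quadratic form Q by σ². The derivative of w = σu
    -- can thus be written in terms of P' and w, without u or its length.
    have hq : ∑ k, starRingEnd ℂ (((σ t : ℂ) • u t) k) * (P' t *ᵥ ((σ t : ℂ) • u t)) k
        = (σ t * σ t : ℂ) * Q t := by
      rw [hQ, hsmul, Finset.mul_sum]
      refine Finset.sum_congr rfl fun k _ => ?_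
      simp only [Pi.smul_apply, smul_eq_mul, map_mul, Complex.conj_ofReal]
      ring
    rw [hq, hsmul]
    have hre : (σ t * σ t : ℂ) * Q t + starRingEnd ℂ ((σ t * σ t : ℂ) * Q t)
        = 2 * ((σ t * σ t * (Q t).re : ℝ) : ℂ) := by
      rw [map_mul, map_mul, Complex.conj_ofReal, ← mul_add, Complex.add_conj]
      push_cast
      ring
    rw [hre, inv_mul_cancel_left₀ two_ne_zero]
    simp only [Pi.smul_apply, smul_eq_mul]
    push_cast
    ring

end UnitSection

/-! ### Symbol estimates for the spectral data and construction of a diagonaliser. -/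

section Construction

variable {n d : ℕ} {A A₁ : ℝ → Freq n → Mat d} {c : ℝ}

theorem charpoly_smul_eq {B : Mat d} {l : Fin d → ℂ} (hch : B.charpoly = ∏ j, (X - C (l j)))
    {ρ : ℂ} (hρ : ρ ≠ 0) : (ρ • B).charpoly = ∏ j, (X - C (ρ * l j)) := by
  refine Polynomial.funext fun y => ?_
  have h1 : Matrix.scalar (Fin d) y - ρ • B = ρ • (Matrix.scalar (Fin d) (ρ⁻¹ * y) - B) := by
    rw [smul_sub]
    congr 1
    ext i j
    by_cases hij : i = j <;> simp [hij, hρ]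
  rw [Matrix.eval_charpoly, h1, Matrix.det_smul, ← Matrix.eval_charpoly, hch, eval_prod, eval_prod,
    Fintype.card_fin, ← Fin.prod_const, ← Finset.prod_mul_distrib]
  refine Finset.prod_congr rfl fun j _ => ?_
  simp only [eval_sub, eval_X, eval_C]
  field_simp

/-- Hypothesis (A2) gives the eigenvalues pointwise without compatible labels; sorting makes the
labelling canonical, so that continuity in t can follow. Division by |ξ| makes the gap uniform in ξ.
-/
theorem IsUniformlyStrictlyHyperbolic.exists_ordered_eigenvalues
    (hA : IsUniformlyStrictlyHyperbolic A A₁) :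
    ∃ κ : ℝ, 0 < κ ∧ ∃ lam : Freq n → ℝ → Fin d → ℝ, ∀ ξ, ξ ≠ 0 → ∀ t, 0 ≤ t →
      (((‖ξ‖⁻¹ : ℝ) : ℂ) • A₁ t ξ).charpoly = ∏ j, (X - C ((lam ξ t j : ℝ) : ℂ)) ∧
      StrictMono (lam ξ t) ∧ ∀ i j, i ≠ j → κ ≤ |lam ξ t i - lam ξ t j| := by
  obtain ⟨κ, hκ, hev⟩ := hA.eigenvalues
  refine ⟨κ, hκ, ?_⟩
  have key : ∀ ξ : Freq n, ∀ t : ℝ, ∃ l : Fin d → ℝ, ξ ≠ 0 → 0 ≤ t →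
      (((‖ξ‖⁻¹ : ℝ) : ℂ) • A₁ t ξ).charpoly = ∏ j, (X - C ((l j : ℝ) : ℂ)) ∧
      StrictMono l ∧ ∀ i j, i ≠ j → κ ≤ |l i - l j| := by
    intro ξ t
    by_cases h : ξ ≠ 0 ∧ 0 ≤ t
    swap
    · exact ⟨0, fun h1 h2 => absurd ⟨h1, h2⟩ h⟩
    obtain ⟨ev, hch, hsep⟩ := hev t h.2 ξ h.1
    have hξ : 0 < ‖ξ‖ := norm_pos_iff.2 h.1
    have hsep' : ∀ i j, i ≠ j → κ ≤ |‖ξ‖⁻¹ * ev (Tuple.sort ev i)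
        - ‖ξ‖⁻¹ * ev (Tuple.sort ev j)| := fun i j hij => by
      have := hsep _ _ ((Tuple.sort ev).injective.ne hij)
      rw [← mul_sub, abs_mul, abs_of_pos (inv_pos.2 hξ), ← div_eq_inv_mul, le_div_iff₀ hξ]
      exact this
    refine ⟨fun j => ‖ξ‖⁻¹ * ev (Tuple.sort ev j), fun _ _ => ⟨?_, ?_, hsep'⟩⟩
    · rw [charpoly_smul_eq hch (by exact_mod_cast (inv_pos.2 hξ).ne'),
        ← Equiv.prod_comp (Tuple.sort ev)]
      simp only [Complex.ofReal_mul]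
    · refine Monotone.strictMono_of_injective
        (fun i j hij => mul_le_mul_of_nonneg_left (Tuple.monotone_sort ev hij)
          (inv_pos.2 hξ).le) fun i j hij => ?_
      by_contra hne
      have := hsep' i j hne
      rw [show ‖ξ‖⁻¹ * ev (Tuple.sort ev i) = ‖ξ‖⁻¹ * ev (Tuple.sort ev j) from hij, sub_self, abs_zero] at this
      linarith
  choose lam hlam using key
  exact ⟨lam, fun ξ hξ t ht => hlam ξ t hξ ht⟩

theorem IsSymbolUpTo.specProj {N : ℕ} {b : ℝ → Freq n → Mat d} {l : Freq n → ℝ → Fin d → ℂ}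
    {κ : ℝ} (hc : 0 < c) (hκ : 0 < κ) (hb : ∀ i j, IsSymbolUpTo c N 0 fun t ξ => b t ξ i j)
    (hl : ∀ j, IsSymbolUpTo c N 0 fun t ξ => l ξ t j)
    (hsep : ∀ ξ, ξ ≠ 0 → ∀ t, 0 ≤ t → ∀ i j, i ≠ j → κ ≤ ‖l ξ t i - l ξ t j‖) (j : Fin d) :
    ∀ i k, IsSymbolUpTo c N 0 fun t ξ => HypSys.specProj (b t ξ) (l ξ t) j i k := by
  have hone : ∀ i k, IsSymbolUpTo c N 0 fun _ (_ : Freq n) => (1 : Mat d) i k :=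
    fun i k => IsSymbolUpTo.const _
  have key : ∀ L : List (Fin d), j ∉ L → ∀ i k, IsSymbolUpTo c N 0 fun t ξ =>
      (L.map fun k => (l ξ t j - l ξ t k)⁻¹ • (b t ξ - l ξ t k • (1 : Mat d))).prod i k := by
    intro L hL
    induction L with
    | nil => simpa using hone
    | cons m L ih =>
      simp only [List.mem_cons, not_or] at hL
      simp only [List.map_cons, List.prod_cons]
      have h1 := ((hl j).sub (hl m)).inv hκ (fun ξ hξ t ht h0 => by
        have := hsep ξ hξ t ht j m hL.1
        rw [h0, norm_zero] at this
        linarith) (fun t ξ hz => hsep ξ (hz.ne_zero hc) t hz.1 j m hL.1)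
      have h2 : ∀ i k, IsSymbolUpTo c N 0 fun t ξ =>
          ((l ξ t j - l ξ t m)⁻¹ • (b t ξ - l ξ t m • (1 : Mat d))) i k := fun i k => by
        have := h1.mul ((hb i k).sub ((hl m).mul (hone i k)))
        simpa using this
      exact fun i k => by simpa using IsSymbolUpTo.matrix_mul h2 (ih hL.2) i k
  exact key _ (by simp)

/-- The normalised eigenvalues of the principal part satisfy symbol estimates. -/
theorem isSymbolUpTo_eigenvalue {b : ℝ → Freq n → Mat d} {lam : Freq n → ℝ → Fin d → ℝ} {κ : ℝ}
    (hc : 0 < c) (hκ : 0 < κ) (hb : ∀ N i j, IsSymbolUpTo c N 0 fun t ξ => b t ξ i j)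
    (hlam : ∀ ξ, ξ ≠ 0 → ∀ t, 0 ≤ t →
      (b t ξ).charpoly = ∏ j, (X - C ((lam ξ t j : ℝ) : ℂ)) ∧
      StrictMono (lam ξ t) ∧ ∀ i j, i ≠ j → κ ≤ |lam ξ t i - lam ξ t j|) (N : ℕ) :
    ∀ j, IsSymbolUpTo c N 0 fun t ξ => ((lam ξ t j : ℝ) : ℂ) := by
  have hbd : ∀ j, HasZoneBound c 0 fun t (ξ : Freq n) => ((lam ξ t j : ℝ) : ℂ) := fun j => by
    obtain ⟨K, -, hK⟩ := exists_norm_le_of_isSymbolUpTo (hb 0)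
    exact ⟨K, fun t ξ hz => (norm_eigenvalue_le
      (hlam ξ (hz.ne_zero hc) t hz.1).1 j).trans (hK t ξ hz)⟩
  have hderiv : ∀ ξ, ξ ≠ 0 → ∀ t, 0 ≤ t → HasDerivWithinAt (fun τ => b τ ξ)
      (Matrix.of fun i j => derivWithin (fun τ => b τ ξ i j) (Ici 0) t) (Ici 0) t :=
    fun ξ hξ t ht => hasDerivWithinAt_of_entries fun i j => (hb 1 i j).hasDerivWithinAt hξ ht
  have hbc : ∀ ξ, ξ ≠ 0 → ContinuousOn (fun τ => b τ ξ) (Ici 0) := fun ξ hξ t ht =>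
    (hderiv ξ hξ t ht).continuousWithinAt
  induction N with
  | zero =>
    exact fun j => ⟨hbd j, fun ξ hξ => Complex.continuous_ofReal.comp_continuousOn
      (continuousOn_eigenvalue (hbc ξ hξ) (fun t ht => (hlam ξ hξ t ht).1)
        (fun t ht => (hlam ξ hξ t ht).2.1) hκ (fun t ht => (hlam ξ hξ t ht).2.2) j)⟩
  | succ N ih =>
    intro j
    -- Bootstrap: eigenvalues controlled to order N give projections to order N, hence tr(P b'), the
    -- derivative of the eigenvalue, to order N.
    have hP := IsSymbolUpTo.specProj hc hκ (hb N) ih (fun ξ hξ t ht i j hij => by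
      rw [← Complex.ofReal_sub, Complex.norm_real]
      exact (hlam ξ hξ t ht).2.2 i j hij) j
    have hb' : ∀ i j, IsSymbolUpTo c N 1 fun t ξ =>
        (Matrix.of fun i j => derivWithin (fun τ => b τ ξ i j) (Ici 0) t : Mat d) i j :=
      fun i j => (hb (N + 1) i j).derivWithin_time hc
    have htr := IsSymbolUpTo.sum Finset.univ fun i _ => IsSymbolUpTo.matrix_mul hP hb' i i
    refine ⟨hbd j, _, fun ξ hξ t ht => hasDerivWithinAt_eigenvalue ht (hbc ξ hξ)
      (hderiv ξ hξ t ht) (fun t ht => (hlam ξ hξ t ht).1) (fun t ht => (hlam ξ hξ t ht).2.1) hκ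
      (fun t ht => (hlam ξ hξ t ht).2.2) j, htr⟩

theorem norm_le_one_of_sum_conj_mul_eq_one {w : Fin d → ℂ}
    (hw : ∑ k, starRingEnd ℂ (w k) * w k = 1) (i : Fin d) : ‖w i‖ ≤ 1 := by
  have h1 : ∑ k, ‖w k‖ ^ 2 = 1 := by
    have h2 : ((∑ k, ‖w k‖ ^ 2 : ℝ) : ℂ) = 1 := by
      rw [← hw]
      push_cast
      exact Finset.sum_congr rfl fun k _ => (Complex.conj_mul' (w k)).symm
    exact_mod_cast h2
  have h3 := Finset.single_le_sum (f := fun k => ‖w k‖ ^ 2) (fun k _ => sq_nonneg _)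
    (Finset.mem_univ i)
  rw [h1] at h3
  exact (sq_le_one_iff₀ (norm_nonneg _)).1 h3

/-- Symbol estimates for unit sections of the range of a projection. -/
theorem isSymbolUpTo_unit_section {P P' : Freq n → ℝ → Mat d} {w : Freq n → ℝ → Fin d → ℂ}
    (hc : 0 < c) (hP' : ∀ N i j, IsSymbolUpTo c N 1 fun t ξ => P' ξ t i j)
    (hw : ∀ ξ, ξ ≠ 0 → ∀ t, 0 ≤ t → ∑ k, starRingEnd ℂ (w ξ t k) * w ξ t k = 1 ∧
      P ξ t *ᵥ w ξ t = w ξ t ∧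
      ∀ i, HasDerivWithinAt (fun τ => w ξ τ i) ((P' ξ t *ᵥ w ξ t) i - w ξ t i * (2⁻¹ *
        (∑ k, starRingEnd ℂ (w ξ t k) * (P' ξ t *ᵥ w ξ t) k
          + starRingEnd ℂ (∑ k, starRingEnd ℂ (w ξ t k) * (P' ξ t *ᵥ w ξ t) k))))
        (Ici 0) t) (N : ℕ) :
    ∀ i, IsSymbolUpTo c N 0 fun t ξ => w ξ t i := by
  have hbd : ∀ i, HasZoneBound c 0 fun t (ξ : Freq n) => w ξ t i := fun i =>
    ⟨1, fun t ξ hz => by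
      simpa using norm_le_one_of_sum_conj_mul_eq_one (hw ξ (hz.ne_zero hc) t hz.1).1 i⟩
  induction N with
  | zero =>
    exact fun i => ⟨hbd i, fun ξ hξ t ht => ((hw ξ hξ t ht).2.2 i).continuousWithinAt⟩
  | succ N ih =>
    intro i
    refine ⟨hbd i, _, fun ξ hξ t ht => (hw ξ hξ t ht).2.2 i, ?_⟩
    have h1 : ∀ i, IsSymbolUpTo c N 1 fun t ξ => (P' ξ t *ᵥ w ξ t) i := fun i =>
      IsSymbolUpTo.sum Finset.univ fun k _ => (hP' N i k).mul (ih k)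
    have h2 : IsSymbolUpTo c N 1 fun t ξ => ∑ k, starRingEnd ℂ (w ξ t k) * (P' ξ t *ᵥ w ξ t) k :=
      IsSymbolUpTo.sum Finset.univ fun k _ => by simpa using (ih k).star.mul (h1 k)
    have h3 := (ih i).mul ((h2.add h2.star).const_mul 2⁻¹)
    rw [zero_add] at h3
    exact (h1 i).sub h3

/-- The columns of M are unit sections of the ranges of the spectral projections. The choice is
independent for each ξ, while the constants stay uniform because the differential equation and the
unit length determine the estimates. -/
theorem exists_isDiagonaliser (hA : IsUniformlyStrictlyHyperbolic A A₁) :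
    ∃ M : ℝ → Freq n → Mat d, IsDiagonaliser (IsTimeSymbol 0 0) A₁ M := by
  obtain ⟨κ, hκ, lam, hlam⟩ := hA.exists_ordered_eigenvalues
  obtain ⟨c, hc, hb'⟩ := hA.principal_symbol.isTimeSymbol.exists_isSymbolUpTo
  set b : ℝ → Freq n → Mat d := fun t ξ => ((‖ξ‖⁻¹ : ℝ) : ℂ) • A₁ t ξ with hbdef
  have hb : ∀ N i j, IsSymbolUpTo c N 0 fun t ξ => b t ξ i j := fun N i j => by
    simpa [hbdef] using hb' N i j
  set P : Fin d → Freq n → ℝ → Mat d := fun j ξ t =>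
    specProj (b t ξ) (fun k => (lam ξ t k : ℂ)) j with hPdef
  have hP : ∀ j N i k, IsSymbolUpTo c N 0 fun t ξ => P j ξ t i k := fun j N =>
    IsSymbolUpTo.specProj hc hκ (hb N) (isSymbolUpTo_eigenvalue hc hκ hb hlam N)
      (fun ξ hξ t ht i j hij => by
        rw [← Complex.ofReal_sub, Complex.norm_real]
        exact (hlam ξ hξ t ht).2.2 i j hij) j
  have hinj : ∀ ξ, ξ ≠ 0 → ∀ t, 0 ≤ t → Function.Injective fun k => (lam ξ t k : ℂ) :=
    fun ξ hξ t ht => Complex.ofReal_injective.comp (hlam ξ hξ t ht).2.1.injective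
  set P' : Fin d → Freq n → ℝ → Mat d := fun j ξ t =>
    Matrix.of fun i k => derivWithin (fun τ => P j ξ τ i k) (Ici 0) t with hP'def
  have hP' : ∀ j N i k, IsSymbolUpTo c N 1 fun t ξ => P' j ξ t i k := fun j N i k =>
    (hP j (N + 1) i k).derivWithin_time hc
  have hsec : ∀ j (ξ : Freq n), ∃ w : ℝ → Fin d → ℂ, ξ ≠ 0 → ∀ t, 0 ≤ t →
      ∑ k, starRingEnd ℂ (w t k) * w t k = 1 ∧ P j ξ t *ᵥ w t = w t ∧
      ∀ i, HasDerivWithinAt (fun τ => w τ i) ((P' j ξ t *ᵥ w t) i - w t i * (2⁻¹ *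
        (∑ k, starRingEnd ℂ (w t k) * (P' j ξ t *ᵥ w t) k
          + starRingEnd ℂ (∑ k, starRingEnd ℂ (w t k) * (P' j ξ t *ᵥ w t) k))))
        (Ici 0) t := by
    intro j ξ
    by_cases hξ : ξ = 0
    · exact ⟨0, fun h => absurd hξ h⟩
    obtain ⟨w, hw⟩ := exists_unit_section_of_projection (P := P j ξ) (P' := P' j ξ)
      (fun t ht => hasDerivWithinAt_of_entries fun i k =>
        (hP j 1 i k).hasDerivWithinAt hξ ht)
      (continuousOn_pi.2 fun i => continuousOn_pi.2 fun k => (hP' j 0 i k).continuousOn hξ)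
      (fun t ht => specProj_mul_self (hlam ξ hξ t ht).1 (hinj ξ hξ t ht) j)
      (specProj_ne_zero (hlam ξ hξ 0 le_rfl).1 (hinj ξ hξ 0 le_rfl) j)
    exact ⟨w, fun _ => hw⟩
  choose w hw using hsec
  have hws : ∀ j N i, IsSymbolUpTo c N 0 fun t ξ => w j ξ t i := fun j N =>
    isSymbolUpTo_unit_section hc (hP' j) (hw j) N
  set M : ℝ → Freq n → Mat d := fun t ξ => Matrix.of fun i j => w j ξ t i with hM
  -- The rows w_j^* P_j form the inverse, since P_j P_k = 0 for j ≠ k even though the columns need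
  -- not be orthogonal. Its entries are visibly symbols, so det M need not be bounded below.
  set W : ℝ → Freq n → Mat d := fun t ξ =>
    Matrix.of fun j k => ∑ i, starRingEnd ℂ (w j ξ t i) * P j ξ t i k with hW
  have hcol : ∀ (t : ℝ) ξ (Z : Mat d) i j, (Z * M t ξ) i j = (Z *ᵥ w j ξ t) i :=
    fun t ξ Z i j => rfl
  have hWM : ∀ ξ, ξ ≠ 0 → ∀ t, 0 ≤ t → W t ξ * M t ξ = 1 := by
    intro ξ hξ t ht
    ext j k
    have h1 : (W t ξ * M t ξ) j k
        = ∑ i, starRingEnd ℂ (w j ξ t i) * (P j ξ t *ᵥ w k ξ t) i := by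
      simp only [Matrix.mul_apply, hW, hM, Matrix.of_apply, Matrix.mulVec, dotProduct,
        Finset.sum_mul, Finset.mul_sum]
      rw [Finset.sum_comm]
      simp only [mul_assoc]
    rw [h1]
    by_cases hjk : j = k
    · subst hjk
      rw [(hw j ξ hξ t ht).2.1, (hw j ξ hξ t ht).1, Matrix.one_apply_eq]
    · rw [← (hw k ξ hξ t ht).2.1, Matrix.mulVec_mulVec]
      have h2 : P j ξ t * P k ξ t = 0 := specProj_mul_of_ne (hlam ξ hξ t ht).1 hjk
      simp [h2, hjk]
  have hMinv : ∀ ξ, ξ ≠ 0 → ∀ t, 0 ≤ t → (M t ξ)⁻¹ = W t ξ := fun ξ hξ t ht =>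
    Matrix.inv_eq_left_inv (hWM ξ hξ t ht)
  refine ⟨M, fun t ht ξ hξ => ?_, fun t ht ξ hξ => ?_, fun i j => ?_, fun i j => ?_⟩
  · exact ⟨⟨M t ξ, W t ξ, mul_eq_one_comm.1 (hWM ξ hξ t ht), hWM ξ hξ t ht⟩, rfl⟩
  · have hξ' : ((‖ξ‖ : ℝ) : ℂ) ≠ 0 := by exact_mod_cast (norm_pos_iff.2 hξ).ne'
    have hA₁ : A₁ t ξ = ((‖ξ‖ : ℝ) : ℂ) • b t ξ := by
      simp [hbdef, smul_smul, hξ']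
    have h1 : b t ξ * M t ξ = M t ξ * Matrix.diagonal fun j => (lam ξ t j : ℂ) := by
      ext i j
      rw [hcol, Matrix.mul_diagonal, ← (hw j ξ hξ t ht).2.1, Matrix.mulVec_mulVec]
      have h2 : b t ξ * P j ξ t = (lam ξ t j : ℂ) • P j ξ t :=
        mul_specProj (hlam ξ hξ t ht).1 j
      rw [h2, Matrix.smul_mulVec, (hw j ξ hξ t ht).2.1, Pi.smul_apply, smul_eq_mul, mul_comm]
      rfl
    rw [hMinv ξ hξ t ht, hA₁, mul_smul_comm, smul_mul_assoc, mul_assoc, h1, ← mul_assoc,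
      hWM ξ hξ t ht, one_mul]
    exact (Matrix.isDiag_diagonal _).smul _
  · exact isScalarTimeSymbol_of_isSymbolUpTo hc fun N => hws j N i
  · refine isScalarTimeSymbol_of_isSymbolUpTo hc fun N => ?_
    have h1 : IsSymbolUpTo c N 0 fun t ξ => W t ξ i j :=
      IsSymbolUpTo.sum Finset.univ fun k _ => by
        simpa using (hws i N k).star.mul (hP i N k j)
    exact h1.congr hc fun ξ hξ t ht => by
      beta_reduce
      rw [hMinv ξ hξ t ht]

end Construction

theorem IsDiagonaliser.mono {n d : ℕ} {S T : (ℝ → Freq n → Mat d) → Prop}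
    {A₁ M : ℝ → Freq n → Mat d} (hST : ∀ a, S a → T a) (h : IsDiagonaliser S A₁ M) :
    IsDiagonaliser T A₁ M :=
  ⟨h.isUnit, h.isDiag, hST _ h.symbol, hST _ h.symbol_inv⟩

end HypSys

theorem theorem3 {n d : ℕ} (A A₁ : ℝ → HypSys.Freq n → HypSys.Mat d)
    (hA : HypSys.IsUniformlyStrictlyHyperbolic A A₁) :
    (∀ M : ℝ → HypSys.Freq n → HypSys.Mat d,
      HypSys.IsDiagonaliser (HypSys.IsSymbol 0 0) A₁ M →
        (HypSys.GeneralisedEnergyConservation A ↔ HypSys.BoundedDiagonalIntegrals A A₁ M)) ∧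
    (∃ M : ℝ → HypSys.Freq n → HypSys.Mat d,
      HypSys.IsDiagonaliser (HypSys.IsTimeSymbol 0 0) A₁ M) ∧
    (∀ M : ℝ → HypSys.Freq n → HypSys.Mat d,
      HypSys.IsDiagonaliser (HypSys.IsTimeSymbol 0 0) A₁ M →
        (HypSys.GeneralisedEnergyConservation A ↔ HypSys.BoundedDiagonalIntegrals A A₁ M)) :=
  ⟨fun _ hM => HypSys.generalisedEnergyConservation_iff hA
      (hM.mono fun _ => HypSys.IsSymbol.isTimeSymbol),
    HypSys.exists_isDiagonaliser hA,
    fun _ hM => HypSys.generalisedEnergyConservation_iff hA hM⟩
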